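/- Let $p$ be an odd prime, $n>1$ an integer, and $q=p^{n-1}$. **Formal group laws.** Define $\ell_k\in\mathbf{Q}_p[v_1,v_2,\dots]$ by $\ell_0=1$ and $p\,\ell_k=\sum_{0\le i\le k}\ell_i\,v_{k-i}^{p^i}$ for $k\ge 1$, where $v_0=p$ (so the $v_i$ are the Araki generators). There is a formal group law over $\mathbf{Z}_p[v_1,v_2,\dots]$ with logarithm $\sum_k \ell_k t^{p^k}$ (the universal $p$-typical one, i.e. that of $BP$). Let * $G(n)$ be its image under $v_i\mapsto 0$ for $i>n$ (the formal group law of $E(n)$); * $H$ be its image over $\mathbf{F}_p$ under $v_{n-1}\mapsto 1$ and $v_i\mapsto 0$ for $i\ne n-1$ (the Honda formal group law of height $n-1$); it satisfies $[p]_H(t)=t^q$; * $F(s,t)=w\,G(n)(w^{-1}s,w^{-1}t)$, where $w$ is a unit with $w^{q-1}=v_{n-1}$; its coefficients are polynomials over $\mathbf{Z}_p$ in $w_i=v_iw^{-(p^i-1)}$ for $i=1,\dots,n-2$ and $i=n$; * $F_0$ be the formal group law over $\mathbf{F}_p[y^{-1}]$ obtained from $F$ by reducing modulo $p$ and putting $w_i=0$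 for $1\le i\le n-2$ and $w_n=-y^{(1-p)q}$. **The series $\Phi$.** There is a unique power series $\tau(t)\in\mathbf{F}_p[y^{-1}][[t]]$ without constant term such that $[p]_{F_0}=[p]_H\circ\tau$. Let $\tau^{-1}$ be its inverse under composition. For a power series $f$ over $\mathbf{F}_p[y^{-1}]$ let $f^{\sigma^r}$ be the series whose coefficients are those of $f$ raised to the power $q^r$, and write $\tau^{-\sigma^r}=(\tau^{-1})^{\sigma^r}$. The limit $$\Phi=\lim_{r\to\infty}\tau^{-\sigma^r}\circ\tau^{-\sigma^{r-1}}\circ\dots\circ\tau^{-\sigma}$$ exists, and is unique, in $\mathbf{F}_p[[y^{-1}]][[t]]$ with the $(y^{-1})$-adic topology. **Proposition.** $\Phi$ is a strict isomorphism $F_0\to H$ of formal group laws over $\mathbf{F}_p[[y^{-1}]]$ (that is, $\Phi(t)\equiv t \bmod t^2$ and $\Phi(F_0(s,t))=H(\Phi(s),\Phi(t))$) with $\Phi(t)\equiv t \bmod y^{-1}$, and it is the only strict isomorphism $F_0\to H$ over $\mathbf{F}_p[[y^{-1}]]$ that is congruent to $t$ modulo $y^{-1}$. -/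

import Mathlib

/-! ### Generalities on one-dimensional formal group laws -/

namespace FormalGroup

/-- The composite `f ∘ g`, i.e. `f(g(t))`, of power series in one variable `t`. It is only used
for `g` without constant term. -/
noncomputable def comp {R : Type*} [CommRing R] (f g : PowerSeries R) : PowerSeries R :=
  PowerSeries.subst g f

/-- The coordinate `t`, as a point of `F` with values in `R⟦t⟧`. -/
noncomputable def tPoint {R : Type*} [CommRing R] (F : FormalGroup R) : F.Point Unit :=
  ⟨PowerSeries.X, PowerSeries.HasSubst.X'⟩

/-- The series `[k]_F(t) = t +_F ⋯ +_F t` (`k` summands). -/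
noncomputable def nSeries {R : Type*} [CommRing R] (F : FormalGroup R) (k : ℕ) : PowerSeries R :=
  (k • F.tPoint).val

/-- `φ` is a strict isomorphism `F → G`: `φ(t) ≡ t mod t²` and `φ(F(s,t)) = G(φ(s), φ(t))`.
(The first condition makes `φ` invertible under composition.) -/
structure IsStrictIso {R : Type*} [CommRing R] (F G : FormalGroup R) (φ : PowerSeries R) :
    Prop where
  constantCoeff_eq : PowerSeries.constantCoeff φ = 0
  coeff_one_eq : PowerSeries.coeff 1 φ = 1
  map_add : PowerSeries.subst F.toPowerSeries φ =
    MvPowerSeries.subst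
      ![PowerSeries.subst (MvPowerSeries.X 0 : MvPowerSeries (Fin 2) R) φ,
        PowerSeries.subst (MvPowerSeries.X 1 : MvPowerSeries (Fin 2) R) φ] G.toPowerSeries

open MvPowerSeries in
theorem twist_subst_aux {R : Type*} [CommRing R] {σ : Type*} (F : FormalGroup R) (u : Rˣ)
    {f g : MvPowerSeries σ R} (hf : PowerSeries.HasSubst f) (hg : PowerSeries.HasSubst g) :
    MvPowerSeries.subst ![f, g] ((u : R) • rescale (fun _ => ((u⁻¹ : Rˣ) : R)) F.toPowerSeries) =
      (u : R) • MvPowerSeries.subst ![((u⁻¹ : Rˣ) : R) • f, ((u⁻¹ : Rˣ) : R) • g]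
        F.toPowerSeries := by
  have h : HasSubst ![f, g] := hasSubst_of_constantCoeff_nilpotent (by
    intro s; fin_cases s
    · exact hf
    · exact hg)
  rw [subst_smul h, rescale_eq_subst, subst_comp_subst_apply (HasSubst.smul_X _) h]
  congr 2
  funext s
  fin_cases s <;> simp [subst_smul h, subst_X h]

open MvPowerSeries in
/-- The twist `F^u(s,t) = u F(u⁻¹ s, u⁻¹ t)` of a formal group law by a unit `u`. -/
noncomputable def twist {R : Type*} [CommRing R] (F : FormalGroup R) (u : Rˣ) :
    FormalGroup R where
  toPowerSeries := (u : R) • rescale (fun _ => ((u⁻¹ : Rˣ) : R)) F.toPowerSeries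
  zero_constantCoeff := by
    have h := F.zero_constantCoeff
    rw [← coeff_zero_eq_constantCoeff_apply] at h ⊢
    rw [coeff_smul, coeff_rescale, h, mul_zero, mul_zero]
  lin_coeff_X := by
    simp [coeff_rescale, F.lin_coeff_X]
  lin_coeff_Y := by
    simp [coeff_rescale, F.lin_coeff_Y]
  assoc := by
    have hX : ∀ i : Fin 3, PowerSeries.HasSubst (X i : MvPowerSeries (Fin 3) R) :=
      fun i => PowerSeries.HasSubst.X i
    have hs : ∀ (a : R) {f : MvPowerSeries (Fin 3) R}, PowerSeries.HasSubst f →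
        PowerSeries.HasSubst (a • f) := fun a f hf => by
      rw [smul_eq_C_mul]; exact hf.mul_right
    have hF : ∀ {f g : MvPowerSeries (Fin 3) R}, PowerSeries.HasSubst f →
        PowerSeries.HasSubst g → PowerSeries.HasSubst (F.toPowerSeries.subst ![f, g]) :=
      fun hf hg => (HAdd.hAdd (α := F.Point (Fin 3)) (β := F.Point (Fin 3)) ⟨_, hf⟩ ⟨_, hg⟩).prop
    rw [twist_subst_aux F u (hX 0) (hX 1), twist_subst_aux F u (hX 1) (hX 2),
      twist_subst_aux F u (hs _ (hF (hs _ (hX 0)) (hs _ (hX 1)))) (hX 2),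
      twist_subst_aux F u (hX 0) (hs _ (hF (hs _ (hX 1)) (hs _ (hX 2)))),
      smul_smul, smul_smul, Units.inv_mul, one_smul, one_smul,
      F.assoc' (hs _ (hX 0)) (hs _ (hX 1)) (hs _ (hX 2))]

end FormalGroup

/-! ### The formal group laws `G(n)`, `H` and `F₀` -/

namespace TateHonda

open FormalGroup

section BP

variable (p : ℕ) [Fact p.Prime]

/-- The coefficients `ℓ_k ∈ ℚ_p[v₁, v₂, …]` of the logarithm `∑ ℓ_k t^{p^k}` in terms of the Araki
generators: `ℓ₀ = 1` and `p ℓ_k = ∑_{0 ≤ i ≤ k} ℓ_i v_{k-i}^{p^i}`, where `v₀ = p`; that is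
`(p - p^{p^k}) ℓ_k = ∑_{0 ≤ i < k} ℓ_i v_{k-i}^{p^i}`. The variable `X j` stands for `v_{j+1}`. -/
noncomputable def logCoeff : ℕ → MvPolynomial ℕ ℚ_[p]
  | 0 => 1
  | k + 1 => MvPolynomial.C (((p : ℚ_[p]) - (p : ℚ_[p]) ^ p ^ (k + 1))⁻¹) *
      ∑ i : Fin (k + 1), logCoeff i * MvPolynomial.X (k - i) ^ p ^ (i : ℕ)

open Classical in
/-- The logarithm `∑_k ℓ_k t^{p^k}`. -/
noncomputable def log : PowerSeries (MvPolynomial ℕ ℚ_[p]) :=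
  PowerSeries.mk fun m => if m = p ^ Nat.log p m then logCoeff p (Nat.log p m) else 0

/-- The formal group law `G` over `ℤ_p[v₁, v₂, …]` has logarithm `∑_k ℓ_k t^{p^k}`:
`log (G(s,t)) = log s + log t` over `ℚ_p[v₁, v₂, …]`. -/
def HasArakiLog (G : FormalGroup (MvPolynomial ℕ ℤ_[p])) : Prop :=
  PowerSeries.subst
      (G.map (MvPolynomial.map (algebraMap ℤ_[p] ℚ_[p]))).toPowerSeries (log p) =
    PowerSeries.subst
        (MvPowerSeries.X 0 : MvPowerSeries (Fin 2) (MvPolynomial ℕ ℚ_[p])) (log p) +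
      PowerSeries.subst
        (MvPowerSeries.X 1 : MvPowerSeries (Fin 2) (MvPolynomial ℕ ℚ_[p])) (log p)

open Classical in
/-- The universal `p`-typical formal group law (that of `BP`), over `ℤ_p[v₁, v₂, …]` with the `v_i`
the Araki generators: the formal group law with logarithm `∑_k ℓ_k t^{p^k}`. -/
noncomputable def bpLaw : FormalGroup (MvPolynomial ℕ ℤ_[p]) :=
  if h : ∃ G, HasArakiLog p G then h.choose else FormalGroup.𝔾ₐ

/-- The formal group law `G(n)` of `E(n)`, with coefficients in `ℤ_p[v₁, …, v_n]`: it is obtained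
from that of `BP` by putting `v_i = 0` for `i > n`. -/
noncomputable def lawG (n : ℕ) : FormalGroup (MvPolynomial ℕ ℤ_[p]) :=
  (bpLaw p).map
    (MvPolynomial.aeval (R := ℤ_[p]) fun j => if j + 1 ≤ n then MvPolynomial.X j else 0).toRingHom

/-- The Honda formal group law of height `h` over `𝔽_p`: the `p`-typical formal group law whose
Araki generators are `v_h = 1` and `v_i = 0` for `i ≠ h`. -/
noncomputable def honda (h : ℕ) : FormalGroup (ZMod p) :=
  (bpLaw p).map (MvPolynomial.eval₂Hom PadicInt.toZMod fun j => if j + 1 = h then 1 else 0)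

end BP

section F0

variable (p n : ℕ) [Fact p.Prime]

/-- Reduction of the coefficients of `G(n)` to the ring `𝔽_p[y⁻¹][w, w⁻¹]`. The variable
`Polynomial.X` stands for `y⁻¹` and `LaurentPolynomial.T 1` for `w`. With `q = p^{n-1}`:
`p, v₁, …, v_{n-2} ↦ 0`, `v_{n-1} ↦ w^{q-1}` and
`v_n = w^{pq-1} w_n ↦ -w^{pq-1} y^{(1-p)q}`. -/
noncomputable def residueMap :
    MvPolynomial ℕ ℤ_[p] →+* LaurentPolynomial (Polynomial (ZMod p)) :=
  MvPolynomial.eval₂Hom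
    ((LaurentPolynomial.C.comp Polynomial.C).comp (PadicInt.toZMod (p := p))) fun j =>
      if j + 2 = n then LaurentPolynomial.T ((p ^ (n - 1) - 1 : ℕ) : ℤ)
      else if j + 1 = n then
        -(LaurentPolynomial.T ((p ^ n - 1 : ℕ) : ℤ) *
          LaurentPolynomial.C (Polynomial.X ^ ((p - 1) * p ^ (n - 1))))
      else 0

/-- The unit `w`. -/
noncomputable def unitW : (LaurentPolynomial (Polynomial (ZMod p)))ˣ :=
  (LaurentPolynomial.isUnit_T 1).unit

/-- `F(s,t) = w G(n)(w⁻¹ s, w⁻¹ t)`, reduced modulo `(p, v₁, …, v_{n-2})`. -/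
noncomputable def lawF : FormalGroup (LaurentPolynomial (Polynomial (ZMod p))) :=
  ((lawG p n).map (residueMap p n)).twist (unitW p)

/-- The formal group law `F₀` over `𝔽_p[y⁻¹]`. The coefficients of `lawF` are homogeneous of
degree zero, i.e. they lie in `𝔽_p[y⁻¹]`; as such they are recovered by putting `w = 1`. -/
noncomputable def lawF0Poly : FormalGroup (Polynomial (ZMod p)) :=
  (lawF p n).map (LaurentPolynomial.eval₂ (RingHom.id _) 1)

/-- `F₀` as a formal group law over `𝔽_p⟦y⁻¹⟧`; `PowerSeries.X` stands for `y⁻¹`. -/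
noncomputable def lawF0 : FormalGroup (PowerSeries (ZMod p)) :=
  (lawF0Poly p n).map Polynomial.coeToPowerSeries.ringHom

/-- The Honda law of height `n - 1`, over `𝔽_p⟦y⁻¹⟧`. -/
noncomputable def lawH : FormalGroup (PowerSeries (ZMod p)) :=
  (honda p (n - 1)).map PowerSeries.C

end F0

/-! ### The infinite composite `Φ` -/

section Phi

variable (p n : ℕ) [Fact p.Prime]

/-- `τ ∈ 𝔽_p[y⁻¹]⟦t⟧` solves `[p]_{F₀} = [p]_H ∘ τ`. -/
def IsTau (τ : PowerSeries (Polynomial (ZMod p))) : Prop :=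
  PowerSeries.constantCoeff τ = 0 ∧
    (lawF0Poly p n).nSeries p = comp (((honda p (n - 1)).map Polynomial.C).nSeries p) τ

/-- `ρ` is the compositional inverse of `τ`. -/
def IsCompInverse {R : Type*} [CommRing R] (τ ρ : PowerSeries R) : Prop :=
  PowerSeries.constantCoeff ρ = 0 ∧ comp τ ρ = PowerSeries.X ∧ comp ρ τ = PowerSeries.X

/-- `f^{σ^r}`: raise all coefficients of `f` to the power `q^r`, where `q = p^{n-1}`. -/
noncomputable def sigmaTwist (r : ℕ) (f : PowerSeries (Polynomial (ZMod p))) :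
    PowerSeries (Polynomial (ZMod p)) :=
  PowerSeries.map (iterateFrobenius (Polynomial (ZMod p)) p ((n - 1) * r)) f

/-- The finite composites `ρ^{σ^r} ∘ ρ^{σ^{r-1}} ∘ ⋯ ∘ ρ^{σ}`. -/
noncomputable def partialComp (ρ : PowerSeries (Polynomial (ZMod p))) :
    ℕ → PowerSeries (Polynomial (ZMod p))
  | 0 => PowerSeries.X
  | r + 1 => comp (sigmaTwist p n (r + 1) ρ) (partialComp ρ r)

/-- `f ≡ g mod (y⁻¹)^N` in `𝔽_p⟦y⁻¹⟧⟦t⟧`. -/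
def CongrMod (N : ℕ) (f g : PowerSeries (PowerSeries (ZMod p))) : Prop :=
  ∀ k, (PowerSeries.X : PowerSeries (ZMod p)) ^ N ∣ PowerSeries.coeff k (f - g)

/-- `Φ = lim_{r → ∞} τ^{-σ^r} ∘ ⋯ ∘ τ^{-σ}` in the `(y⁻¹)`-adic topology on `𝔽_p⟦y⁻¹⟧⟦t⟧`, where
`τ⁻¹` is the compositional inverse of the solution `τ` of `[p]_{F₀} = [p]_H ∘ τ`. -/
def IsPhi (Φ : PowerSeries (PowerSeries (ZMod p))) : Prop :=
  ∃ τ ρ : PowerSeries (Polynomial (ZMod p)), IsTau p n τ ∧ IsCompInverse τ ρ ∧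
    ∀ N : ℕ, ∃ r₀ : ℕ, ∀ r ≥ r₀,
      CongrMod p N
        (PowerSeries.map Polynomial.coeToPowerSeries.ringHom (partialComp p n ρ r)) Φ

end Phi

end TateHonda

/-! ### Substitution of pairs and homomorphisms of formal group laws -/

namespace FormalGroup

variable {R S σ τ : Type*} [CommRing R] [CommRing S]

/-! Let `lawC c` be the `p`-typical law in characteristic `p` with `v_{n-1} = 1`, `v_n = c` and all
other `v_i = 0`. Then `H` is `lawC 0`. Since `q` is odd, `F₀` is `lawC (c^q)` for `c = -y^{-(p-1)}`.
The `q`-power Frobenius twist of `lawC c` is `lawC (c^q)`.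

The Araki formula gives `[p](t) = t^q + c^q t^{pq}`, summed in `lawC (c^q)`. This is the `q`-th
power of `τ_c(t) = t + c t^p`, summed in `lawC c` (`tauC_pow`). As `[p]_H(t) = t^q` and `q`-th roots
are unique in a reduced ring of characteristic `p`, the series `τ` is exactly `τ_c` (`isTau_iff`).
Its `q`-th power is an endomorphism of `lawC (c^q)`, so extracting `q`-th roots shows that `τ_c` is
a homomorphism `lawC (c^q) → lawC c` (`isHom_tauC`).

Hence `τ^{-σ^r}` maps `lawC (c^{q^r})` to `lawC (c^{q^{r+1}})`, and the composites start at `F₀` and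
end at a law whose parameter tends to `0`. Modulo a fixed power of `y⁻¹` the late factors are the
identity and the late targets are `H`. So the limit exists and is a strict isomorphism to `H`
(`isStrictIso_of_limit`).

For uniqueness, a homomorphism `Ψ : F₀ → H` commutes with `[p]`, which amounts to `Ψ ∘ τ^σ = Ψ^σ`
(`comp_tauC_eq_map_iterateFrobenius`). Twisting by `σ` turns a congruence modulo `y^{-N}` into one
modulo `y^{-qN}`, and `τ^σ` is invertible. So agreement modulo `y⁻¹` propagates to all orders
(`eq_of_isHom_of_congrMod_one`).

All this presupposes that the law with the Araki logarithm is integral. That is Hazewinkel's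
functional equation lemma (`funEqOp_log_subst_mem`, `coeff_mem_integralSubring_of_log_eq`). The
Araki formula itself is proved over `ℚ_p`, by comparing logarithms (`nSeries_killExcept`). -/

theorem hasSubst_pair {f g : MvPowerSeries σ R} (hf : PowerSeries.HasSubst f)
    (hg : PowerSeries.HasSubst g) : MvPowerSeries.HasSubst ![f, g] :=
  MvPowerSeries.hasSubst_of_constantCoeff_nilpotent fun s => by
    fin_cases s
    · exact hf
    · exact hg

theorem hasSubst_subst_pair (F : FormalGroup R) {f g : MvPowerSeries σ R}
    (hf : PowerSeries.HasSubst f) (hg : PowerSeries.HasSubst g) :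
    PowerSeries.HasSubst (F.toPowerSeries.subst ![f, g]) :=
  (HAdd.hAdd (α := F.Point σ) (β := F.Point σ) ⟨_, hf⟩ ⟨_, hg⟩).prop

theorem constantCoeff_subst_pair (F : FormalGroup R) {f g : MvPowerSeries σ R}
    (hf : f.constantCoeff = 0) (hg : g.constantCoeff = 0) :
    (F.toPowerSeries.subst ![f, g]).constantCoeff = 0 :=
  MvPowerSeries.constantCoeff_subst_eq_zero
    (hasSubst_pair (.of_constantCoeff_zero hf) (.of_constantCoeff_zero hg))
    (fun i => by fin_cases i <;> assumption) F.zero_constantCoeff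

theorem map_subst_pair (F : MvPowerSeries (Fin 2) R) (h : R →+* S) {f g : MvPowerSeries σ R}
    (hf : PowerSeries.HasSubst f) (hg : PowerSeries.HasSubst g) :
    (F.subst ![f, g]).map h = (F.map h).subst ![f.map h, g.map h] := by
  rw [MvPowerSeries.map_subst (hasSubst_pair hf hg)]
  congr 1
  funext i
  fin_cases i <;> rfl

theorem subst_subst_pair (F : MvPowerSeries (Fin 2) R) {f g : MvPowerSeries σ R}
    (hf : PowerSeries.HasSubst f) (hg : PowerSeries.HasSubst g) {a : σ → MvPowerSeries τ R}
    (ha : MvPowerSeries.HasSubst a) :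
    (F.subst ![f, g]).subst a = F.subst ![f.subst a, g.subst a] := by
  rw [MvPowerSeries.subst_comp_subst_apply (hasSubst_pair hf hg) ha]
  congr 1
  funext i
  fin_cases i <;> rfl

theorem subst_subst_pair' (F : MvPowerSeries (Fin 2) R) {f g : PowerSeries R}
    (hf : PowerSeries.HasSubst f) (hg : PowerSeries.HasSubst g) {a : MvPowerSeries τ R}
    (ha : PowerSeries.HasSubst a) :
    PowerSeries.subst a (F.subst ![f, g]) =
      F.subst ![PowerSeries.subst a f, PowerSeries.subst a g] :=
  subst_subst_pair F hf hg ha.const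

theorem expand_subst_pair (F : MvPowerSeries (Fin 2) R) {k : ℕ} (hk : k ≠ 0)
    {f g : MvPowerSeries σ R} (hf : PowerSeries.HasSubst f) (hg : PowerSeries.HasSubst g) :
    (F.subst ![f, g]).expand k hk = F.subst ![f.expand k hk, g.expand k hk] := by
  rw [MvPowerSeries.expand_subst _ _ (hasSubst_pair hf hg)]
  congr 1
  funext i
  fin_cases i <;> rfl

theorem hasSubst_subst {φ : PowerSeries R} (hφ : φ.constantCoeff = 0) {f : MvPowerSeries σ R}
    (hf : PowerSeries.HasSubst f) : PowerSeries.HasSubst (PowerSeries.subst f φ) :=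
  MvPowerSeries.IsNilpotent_subst hf.const (by
    have : MvPowerSeries.constantCoeff φ = 0 := hφ
    rw [this]; exact IsNilpotent.zero)

theorem constantCoeff_comp {f g : PowerSeries R} (hf : f.constantCoeff = 0)
    (hg : g.constantCoeff = 0) : (comp f g).constantCoeff = 0 :=
  PowerSeries.constantCoeff_subst_eq_zero hg f hf

theorem coeff_one_comp {f g : PowerSeries R} (hg : g.constantCoeff = 0) :
    (comp f g).coeff 1 = f.coeff 1 * g.coeff 1 := by
  rw [comp, PowerSeries.coeff_subst' (.of_constantCoeff_zero' hg), finsum_eq_single _ 1]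
  · simp
  · intro k hk
    rcases Nat.eq_zero_or_pos k with rfl | hk'
    · simp [PowerSeries.coeff_one]
    · obtain ⟨u, hu⟩ := PowerSeries.X_dvd_iff.mpr hg
      rw [hu, mul_pow, PowerSeries.coeff_X_pow_mul', if_neg (by omega), smul_zero]

theorem comp_assoc {f g h : PowerSeries R} (hg : g.constantCoeff = 0)
    (hh : h.constantCoeff = 0) : comp f (comp g h) = comp (comp f g) h :=
  (PowerSeries.subst_comp_subst_apply (.of_constantCoeff_zero' hg)
    (.of_constantCoeff_zero' hh) f).symm

theorem comp_X (f : PowerSeries R) : comp f PowerSeries.X = f :=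
  PowerSeries.X_subst f

theorem X_comp {f : PowerSeries R} (hf : f.constantCoeff = 0) : comp PowerSeries.X f = f :=
  PowerSeries.subst_X (.of_constantCoeff_zero' hf)

theorem map_comp (h : R →+* S) {f g : PowerSeries R} (hg : g.constantCoeff = 0) :
    PowerSeries.map h (comp f g) = comp (PowerSeries.map h f) (PowerSeries.map h g) :=
  PowerSeries.map_subst (.of_constantCoeff_zero' hg) f

theorem map_map (F : FormalGroup R) {T : Type*} [CommRing T] (g : S →+* T) (f : R →+* S) :
    (F.map f).map g = F.map (g.comp f) := by
  ext1
  simp [MvPowerSeries.map_map]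

/-- `φ` is a homomorphism `F → G`. -/
structure IsHom (F G : FormalGroup R) (φ : PowerSeries R) : Prop where
  constantCoeff_eq : PowerSeries.constantCoeff φ = 0
  map_add : PowerSeries.subst F.toPowerSeries φ =
    MvPowerSeries.subst
      ![PowerSeries.subst (MvPowerSeries.X 0 : MvPowerSeries (Fin 2) R) φ,
        PowerSeries.subst (MvPowerSeries.X 1 : MvPowerSeries (Fin 2) R) φ] G.toPowerSeries

theorem isStrictIso_iff {F G : FormalGroup R} {φ : PowerSeries R} :
    IsStrictIso F G φ ↔ IsHom F G φ ∧ PowerSeries.coeff 1 φ = 1 :=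
  ⟨fun h => ⟨⟨h.1, h.3⟩, h.2⟩, fun h => ⟨h.1.1, h.2, h.1.2⟩⟩

theorem hasSubst_toPowerSeries (F : FormalGroup R) : PowerSeries.HasSubst F.toPowerSeries :=
  .of_constantCoeff_zero F.zero_constantCoeff

theorem IsHom.subst_pair {F G : FormalGroup R} {φ : PowerSeries R} (h : IsHom F G φ)
    {f g : MvPowerSeries σ R} (hf : PowerSeries.HasSubst f) (hg : PowerSeries.HasSubst g) :
    PowerSeries.subst (F.toPowerSeries.subst ![f, g]) φ =
      G.toPowerSeries.subst ![PowerSeries.subst f φ, PowerSeries.subst g φ] := by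
  have h1 := congrArg (MvPowerSeries.subst ![f, g]) h.map_add
  have hX : ∀ i : Fin 2, PowerSeries.HasSubst (MvPowerSeries.X i : MvPowerSeries (Fin 2) R) :=
    fun i => PowerSeries.HasSubst.X i
  have key : ∀ a : MvPowerSeries (Fin 2) R, PowerSeries.HasSubst a →
      MvPowerSeries.subst ![f, g] (PowerSeries.subst a φ) =
        PowerSeries.subst (MvPowerSeries.subst ![f, g] a) φ := fun a ha =>
    MvPowerSeries.subst_comp_subst_apply ha.const (hasSubst_pair hf hg) φ
  rw [subst_subst_pair _ (hasSubst_subst h.1 (hX 0)) (hasSubst_subst h.1 (hX 1))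
    (hasSubst_pair hf hg), key _ F.hasSubst_toPowerSeries, key _ (hX 0), key _ (hX 1),
    MvPowerSeries.subst_X (hasSubst_pair hf hg), MvPowerSeries.subst_X (hasSubst_pair hf hg)] at h1
  exact h1

theorem IsHom.comp {F G H : FormalGroup R} {φ ψ : PowerSeries R} (hψ : IsHom G H ψ)
    (hφ : IsHom F G φ) : IsHom F H (comp ψ φ) := by
  have hX : ∀ i : Fin 2, PowerSeries.HasSubst (MvPowerSeries.X i : MvPowerSeries (Fin 2) R) :=
    fun i => PowerSeries.HasSubst.X i
  have key : ∀ a : MvPowerSeries (Fin 2) R, PowerSeries.HasSubst a →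
      PowerSeries.subst a (FormalGroup.comp ψ φ) = PowerSeries.subst (PowerSeries.subst a φ) ψ :=
    fun a ha => PowerSeries.subst_comp_subst_apply (.of_constantCoeff_zero' hφ.1) ha ψ
  refine ⟨constantCoeff_comp hψ.1 hφ.1, ?_⟩
  rw [key _ F.hasSubst_toPowerSeries, key _ (hX 0), key _ (hX 1), hφ.map_add,
    hψ.subst_pair (hasSubst_subst hφ.1 (hX 0)) (hasSubst_subst hφ.1 (hX 1))]

theorem IsHom.map {F G : FormalGroup R} {φ : PowerSeries R} (h : IsHom F G φ) (f : R →+* S) :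
    IsHom (F.map f) (G.map f) (PowerSeries.map f φ) := by
  have hX : ∀ i : Fin 2, PowerSeries.HasSubst (MvPowerSeries.X i : MvPowerSeries (Fin 2) R) :=
    fun i => PowerSeries.HasSubst.X i
  refine ⟨by
    rw [← PowerSeries.coeff_zero_eq_constantCoeff_apply, PowerSeries.coeff_map,
      PowerSeries.coeff_zero_eq_constantCoeff_apply, h.1, _root_.map_zero], ?_⟩
  have h1 := congrArg (MvPowerSeries.map f) h.map_add
  rw [map_subst_pair _ _ (hasSubst_subst h.1 (hX 0)) (hasSubst_subst h.1 (hX 1)),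
    PowerSeries.map_subst F.hasSubst_toPowerSeries, PowerSeries.map_subst (hX 0),
    PowerSeries.map_subst (hX 1), MvPowerSeries.map_X, MvPowerSeries.map_X] at h1
  exact h1

theorem isHom_X (F : FormalGroup R) : IsHom F F PowerSeries.X := by
  refine ⟨by simp, ?_⟩
  rw [PowerSeries.subst_X F.hasSubst_toPowerSeries, PowerSeries.subst_X (PowerSeries.HasSubst.X 0),
    PowerSeries.subst_X (PowerSeries.HasSubst.X 1)]
  have : (![MvPowerSeries.X 0, MvPowerSeries.X 1] : Fin 2 → MvPowerSeries (Fin 2) R) =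
      MvPowerSeries.X := by
    funext i; fin_cases i <;> rfl
  rw [this, MvPowerSeries.subst_self]
  rfl

/-- The compositional inverse of a homomorphism is a homomorphism. -/
theorem IsHom.of_comp_eq_X {F G : FormalGroup R} {φ ψ : PowerSeries R} (h : IsHom F G φ)
    (hψ : ψ.constantCoeff = 0) (h1 : FormalGroup.comp φ ψ = PowerSeries.X)
    (h2 : FormalGroup.comp ψ φ = PowerSeries.X) : IsHom G F ψ := by
  refine ⟨hψ, ?_⟩
  have hX : ∀ i : Fin 2, PowerSeries.HasSubst (MvPowerSeries.X i : MvPowerSeries (Fin 2) R) :=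
    fun i => PowerSeries.HasSubst.X i
  have key : ∀ a : MvPowerSeries (Fin 2) R, PowerSeries.HasSubst a →
      PowerSeries.subst (PowerSeries.subst a ψ) φ = a := fun a ha => by
    rw [← PowerSeries.subst_comp_subst_apply (.of_constantCoeff_zero' hψ) ha φ]
    change PowerSeries.subst a (FormalGroup.comp φ ψ) = a
    rw [h1, PowerSeries.subst_X ha]
  have key' : ∀ a : MvPowerSeries (Fin 2) R, PowerSeries.HasSubst a →
      PowerSeries.subst (PowerSeries.subst a φ) ψ = a := fun a ha => by
    rw [← PowerSeries.subst_comp_subst_apply (.of_constantCoeff_zero' h.1) ha ψ]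
    change PowerSeries.subst a (FormalGroup.comp ψ φ) = a
    rw [h2, PowerSeries.subst_X ha]
  have hs := fun i => hasSubst_subst hψ (hX i)
  have e := h.subst_pair (hs 0) (hs 1)
  rw [key _ (hX 0), key _ (hX 1)] at e
  have e2 := congrArg (fun a => PowerSeries.subst a ψ) e
  simp only [key' _ (hasSubst_subst_pair F (hs 0) (hs 1))] at e2
  have e3 : MvPowerSeries.subst ![MvPowerSeries.X 0, MvPowerSeries.X 1] G.toPowerSeries =
      G.toPowerSeries := by
    have : (![MvPowerSeries.X 0, MvPowerSeries.X 1] : Fin 2 → MvPowerSeries (Fin 2) R) =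
        MvPowerSeries.X := by
      funext i; fin_cases i <;> rfl
    rw [this, MvPowerSeries.subst_self]
    rfl
  rw [e2, e3]

theorem nSeries_zero (F : FormalGroup R) : F.nSeries 0 = 0 := by
  rw [nSeries, zero_nsmul]; rfl

theorem nSeries_succ (F : FormalGroup R) (k : ℕ) :
    F.nSeries (k + 1) = F.toPowerSeries.subst ![F.nSeries k, PowerSeries.X] := by
  rw [nSeries, succ_nsmul]; rfl

theorem constantCoeff_nSeries (F : FormalGroup R) (k : ℕ) :
    (F.nSeries k).constantCoeff = 0 := by
  induction k with
  | zero => rw [nSeries_zero, map_zero]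
  | succ k ih =>
    rw [nSeries_succ]
    exact F.constantCoeff_subst_pair ih PowerSeries.constantCoeff_X

theorem map_nSeries (F : FormalGroup R) (f : R →+* S) (k : ℕ) :
    (F.map f).nSeries k = PowerSeries.map f (F.nSeries k) := by
  induction k with
  | zero => simp [nSeries_zero]
  | succ k ih =>
    rw [nSeries_succ, nSeries_succ, ih]
    refine Eq.trans ?_ (map_subst_pair F.toPowerSeries f
      (PowerSeries.HasSubst.of_constantCoeff_zero (F.constantCoeff_nSeries k))
      PowerSeries.HasSubst.X').symm
    congr 3
    exact (PowerSeries.map_X f).symm.trans rfl ▸ rfl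

theorem IsHom.comp_nSeries {F G : FormalGroup R} {φ : PowerSeries R} (h : IsHom F G φ) (k : ℕ) :
    FormalGroup.comp φ (F.nSeries k) = FormalGroup.comp (G.nSeries k) φ := by
  have hφ : PowerSeries.HasSubst φ := .of_constantCoeff_zero' h.1
  induction k with
  | zero =>
    rw [nSeries_zero, nSeries_zero, FormalGroup.comp, FormalGroup.comp,
      ← PowerSeries.coe_substAlgHom hφ, map_zero]
    exact PowerSeries.subst_zero_of_constantCoeff_zero h.1
  | succ k ih =>
    have hF := PowerSeries.HasSubst.of_constantCoeff_zero (F.constantCoeff_nSeries k)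
    have hG := PowerSeries.HasSubst.of_constantCoeff_zero (G.constantCoeff_nSeries k)
    rw [FormalGroup.comp, FormalGroup.comp] at ih ⊢
    rw [nSeries_succ, nSeries_succ, h.subst_pair hF PowerSeries.HasSubst.X', ih,
      subst_subst_pair' _ hG PowerSeries.HasSubst.X' hφ, PowerSeries.subst_X hφ]
    congr 3
    exact PowerSeries.X_subst φ

/-- Multiplication by `k` is an endomorphism of a commutative formal group law. -/
theorem subst_nSeries (F : FormalGroup R) [F.IsComm] {f g : MvPowerSeries σ R}
    (hf : PowerSeries.HasSubst f) (hg : PowerSeries.HasSubst g) (k : ℕ) :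
    PowerSeries.subst (F.toPowerSeries.subst ![f, g]) (F.nSeries k) =
      F.toPowerSeries.subst
        ![PowerSeries.subst f (F.nSeries k), PowerSeries.subst g (F.nSeries k)] := by
  have key : ∀ x : F.Point σ, PowerSeries.subst x.val (F.nSeries k) = (k • x).val := by
    intro x
    induction k with
    | zero =>
      rw [nSeries_zero, zero_nsmul, ← PowerSeries.coe_substAlgHom x.prop, _root_.map_zero]
      rfl
    | succ k ih =>
      rw [nSeries_succ, succ_nsmul, add_apply, subst_subst_pair' _
        (.of_constantCoeff_zero (F.constantCoeff_nSeries k)) PowerSeries.HasSubst.X' x.prop, ih,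
        PowerSeries.subst_X x.prop]
  -- Commutativity of `F` enters here: substituting a point into `[k]` computes its `k`-fold
  -- multiple, and this is additive only in a commutative group of points.
  have h2 : ∀ x y : F.Point σ, k • (x + y) = k • x + k • y := fun x y => nsmul_add x y k
  have h3 : ∀ x y : F.Point σ, PowerSeries.subst (F.toPowerSeries.subst ![x.val, y.val])
      (F.nSeries k) = F.toPowerSeries.subst ![PowerSeries.subst x.val (F.nSeries k),
        PowerSeries.subst y.val (F.nSeries k)] := fun x y => by
    rw [← add_apply, key, h2, add_apply, ← key, ← key]
  exact h3 ⟨f, hf⟩ ⟨g, hg⟩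

instance (F : FormalGroup R) [hF : F.IsComm] (f : R →+* S) : (F.map f).IsComm where
  comm := by
    have h := hF.comm
    change F.toPowerSeries.map f = _
    conv_lhs => rw [h]
    rw [map_subst_pair _ _ (PowerSeries.HasSubst.X 1) (PowerSeries.HasSubst.X 0),
      MvPowerSeries.map_X, MvPowerSeries.map_X]
    rfl

/-- Frobenius twists of a formal group law in characteristic `p`. -/
theorem subst_pair_pow_char_pow (p : ℕ) [ExpChar R p] (F : FormalGroup R) (k : ℕ)
    {f g : MvPowerSeries σ R} (hf : PowerSeries.HasSubst f) (hg : PowerSeries.HasSubst g) :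
    (F.toPowerSeries.subst ![f, g]) ^ p ^ k =
      (F.map (iterateFrobenius R p k)).toPowerSeries.subst ![f ^ p ^ k, g ^ p ^ k] := by
  have hp : p ≠ 0 := expChar_ne_zero R p
  have he : ∀ {f : MvPowerSeries σ R}, PowerSeries.HasSubst f →
      PowerSeries.HasSubst (f.expand (p ^ k) (pow_ne_zero k hp)) := fun hf => by
    rw [PowerSeries.HasSubst, MvPowerSeries.constantCoeff_expand]; exact hf
  simp only [← MvPowerSeries.map_iterateFrobenius_expand p hp]
  rw [expand_subst_pair _ _ hf hg, map_subst_pair _ _ (he hf) (he hg)]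
  rfl

end FormalGroup

/-! ### Uniqueness of `p`-power roots of power series in characteristic `p` -/

theorem MvPowerSeries.expand_injective {R σ : Type*} [CommRing R] {k : ℕ} (hk : k ≠ 0) :
    Function.Injective (MvPowerSeries.expand (σ := σ) (R := R) k hk) := fun f g h => by
  ext m
  rw [← coeff_expand_smul k hk f m, h, coeff_expand_smul]

theorem PowerSeries.expand_injective {R : Type*} [CommRing R] {k : ℕ} (hk : k ≠ 0) :
    Function.Injective (PowerSeries.expand (R := R) k hk) :=
  MvPowerSeries.expand_injective hk

/-- The `p^k`-th power is Frobenius on the coefficients followed by `x ↦ x^{p^k}` on the variables.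
The second map is always injective, the first because the ring is reduced. -/
theorem MvPowerSeries.pow_char_pow_injective {R σ : Type*} [CommRing R] [IsReduced R] (p : ℕ)
    [ExpChar R p] (k : ℕ) : Function.Injective fun f : MvPowerSeries σ R => f ^ p ^ k := by
  intro f g h
  simp only [← MvPowerSeries.map_iterateFrobenius_expand p (expChar_ne_zero R p)] at h
  refine expand_injective (pow_ne_zero k (expChar_ne_zero R p)) ?_
  ext m
  have := congrArg (coeff m) h
  rw [coeff_map, coeff_map] at this
  exact iterateFrobenius_inj R p k this

theorem PowerSeries.pow_char_pow_eq_expand (p : ℕ) {R : Type*} [CommRing R] [ExpChar R p] (k : ℕ)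
    (f : PowerSeries R) : f ^ p ^ k =
      PowerSeries.expand (p ^ k) (pow_ne_zero k (expChar_ne_zero R p))
        (PowerSeries.map (iterateFrobenius R p k) f) := by
  rw [← PowerSeries.map_expand]
  exact (MvPowerSeries.map_iterateFrobenius_expand p (expChar_ne_zero R p) f k).symm

/-! ### Integrality of the universal `p`-typical formal group law -/

namespace TateHonda

open FormalGroup

section Integrality

variable (p : ℕ) [Fact p.Prime]

/-- The inclusion `ℤ_p[v₁, v₂, …] → ℚ_p[v₁, v₂, …]`. -/
noncomputable abbrev toK : MvPolynomial ℕ ℤ_[p] →+* MvPolynomial ℕ ℚ_[p] :=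
  MvPolynomial.map (algebraMap ℤ_[p] ℚ_[p])

theorem toK_injective : Function.Injective (toK p) :=
  MvPolynomial.map_injective _ (IsFractionRing.injective ℤ_[p] ℚ_[p])

/-- The subring `ℤ_p[v₁, v₂, …]` of `ℚ_p[v₁, v₂, …]`. -/
noncomputable abbrev integralSubring : Subring (MvPolynomial ℕ ℚ_[p]) := (toK p).range

theorem X_mem_integralSubring (i : ℕ) : MvPolynomial.X i ∈ integralSubring p :=
  ⟨MvPolynomial.X i, MvPolynomial.map_X _ _⟩

theorem expand_mem_integralSubring {x : MvPolynomial ℕ ℚ_[p]} (hx : x ∈ integralSubring p)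
    (k : ℕ) : MvPolynomial.expand k x ∈ integralSubring p := by
  obtain ⟨y, rfl⟩ := hx
  exact ⟨MvPolynomial.expand k y, MvPolynomial.map_expand _ _ _⟩

theorem logCoeff_zero : logCoeff p 0 = 1 := by rw [logCoeff]

theorem natCast_pow_ne (k : ℕ) : (p : ℚ_[p]) - (p : ℚ_[p]) ^ p ^ (k + 1) ≠ 0 := by
  have hp := (Fact.out : p.Prime)
  have h1 : p < p ^ p ^ (k + 1) := by
    conv_lhs => rw [← pow_one p]
    exact Nat.pow_lt_pow_right hp.one_lt (Nat.one_lt_pow (by omega) hp.one_lt)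
  rw [sub_ne_zero]
  exact_mod_cast h1.ne

/-- The defining relation of the Araki generators. -/
theorem natCast_mul_logCoeff_succ (k : ℕ) :
    (p : MvPolynomial ℕ ℚ_[p]) * logCoeff p (k + 1) =
      (p : MvPolynomial ℕ ℚ_[p]) ^ p ^ (k + 1) * logCoeff p (k + 1) +
        ∑ i ∈ Finset.range (k + 1), logCoeff p i * MvPolynomial.X (k - i) ^ p ^ i := by
  rw [← sub_eq_iff_eq_add', ← sub_mul]
  have h : (p : MvPolynomial ℕ ℚ_[p]) - (p : MvPolynomial ℕ ℚ_[p]) ^ p ^ (k + 1) =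
      MvPolynomial.C ((p : ℚ_[p]) - (p : ℚ_[p]) ^ p ^ (k + 1)) := by simp
  rw [h, logCoeff, ← mul_assoc, ← MvPolynomial.C_mul, mul_inv_cancel₀ (natCast_pow_ne p k),
    MvPolynomial.C_1, one_mul, Finset.sum_range]

/-- The factor `p - p^{p^{k+1}}` in the recursion is `p` times a unit of `ℤ_p`, so each step costs
one power of `p` in the denominator. -/
theorem natCast_pow_mul_logCoeff_mem (k : ℕ) :
    (p : MvPolynomial ℕ ℚ_[p]) ^ k * logCoeff p k ∈ integralSubring p := by
  induction k using Nat.strong_induction_on with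
  | _ k ih =>
    rcases k with _ | k
    · rw [logCoeff_zero, pow_zero, one_mul]
      exact one_mem _
    · have hp := (Fact.out : p.Prime)
      have hu : IsUnit ((1 : ℤ_[p]) - (p : ℤ_[p]) ^ (p ^ (k + 1) - 1)) := by
        apply IsLocalRing.isUnit_one_sub_self_of_mem_nonunits
        rw [PadicInt.mem_nonunits, norm_pow]
        refine pow_lt_one₀ (norm_nonneg _) ?_ ?_
        · rw [PadicInt.norm_p]
          exact inv_lt_one_of_one_lt₀ (by exact_mod_cast hp.one_lt)
        · have := Nat.one_lt_pow (n := k + 1) (by omega) hp.one_lt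
          omega
      obtain ⟨u, hu⟩ := hu
      have hu' : toK p (MvPolynomial.C (u : ℤ_[p])) * (p : MvPolynomial ℕ ℚ_[p]) =
          (p : MvPolynomial ℕ ℚ_[p]) - (p : MvPolynomial ℕ ℚ_[p]) ^ p ^ (k + 1) := by
        have e : p ^ (k + 1) = p ^ (k + 1) - 1 + 1 := by
          have := Nat.one_lt_pow (n := k + 1) (by omega) hp.one_lt
          omega
        rw [hu, MvPolynomial.map_C]
        conv_rhs => rw [e, pow_succ]
        simp [sub_mul]
      have h1 := natCast_mul_logCoeff_succ p k
      rw [← sub_eq_iff_eq_add', ← sub_mul, ← hu'] at h1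
      have h2 : toK p (MvPolynomial.C ((u⁻¹ : ℤ_[p]ˣ) : ℤ_[p])) *
          toK p (MvPolynomial.C (u : ℤ_[p])) = 1 := by
        rw [← map_mul, ← MvPolynomial.C_mul, Units.inv_mul, MvPolynomial.C_1, map_one]
      have h3 : (p : MvPolynomial ℕ ℚ_[p]) ^ (k + 1) * logCoeff p (k + 1) =
          toK p (MvPolynomial.C ((u⁻¹ : ℤ_[p]ˣ) : ℤ_[p])) *
            ∑ i ∈ Finset.range (k + 1), (p : MvPolynomial ℕ ℚ_[p]) ^ (k - i) *
              ((p : MvPolynomial ℕ ℚ_[p]) ^ i * logCoeff p i) *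
              MvPolynomial.X (k - i) ^ p ^ i := by
        have h4 : ∑ i ∈ Finset.range (k + 1), (p : MvPolynomial ℕ ℚ_[p]) ^ (k - i) *
              ((p : MvPolynomial ℕ ℚ_[p]) ^ i * logCoeff p i) *
              MvPolynomial.X (k - i) ^ p ^ i = (p : MvPolynomial ℕ ℚ_[p]) ^ k *
            ∑ i ∈ Finset.range (k + 1), logCoeff p i * MvPolynomial.X (k - i) ^ p ^ i := by
          rw [Finset.mul_sum]
          refine Finset.sum_congr rfl fun i hi => ?_
          rw [← mul_assoc, ← pow_add, Nat.sub_add_cancel (by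
            have := Finset.mem_range.mp hi; omega), mul_assoc]
        rw [h4, ← h1]
        linear_combination (-(p : MvPolynomial ℕ ℚ_[p]) ^ (k + 1) * logCoeff p (k + 1)) * h2
      rw [h3]
      refine mul_mem ⟨_, rfl⟩ (sum_mem fun i hi => mul_mem (mul_mem ?_ (ih i ?_)) ?_)
      · exact pow_mem (natCast_mem _ _) _
      · exact Finset.mem_range.mp hi
      · exact pow_mem (X_mem_integralSubring p _) _

/-- The coefficients `h_{k+1}` of Hazewinkel's functional equation
`p ℓ_{k+1} = ∑_{j ≤ k} h_{j+1} σ^{j+1}(ℓ_{k-j})`, where `σ(v_i) = v_i^p`. -/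
noncomputable def funEqCoeff (k : ℕ) : MvPolynomial ℕ ℚ_[p] :=
  (p : MvPolynomial ℕ ℚ_[p]) * logCoeff p (k + 1) -
    ∑ j : Fin k, funEqCoeff j * MvPolynomial.expand (p ^ (j + 1 : ℕ)) (logCoeff p (k - j))

theorem natCast_mul_logCoeff_succ_eq_sum_funEqCoeff (k : ℕ) :
    (p : MvPolynomial ℕ ℚ_[p]) * logCoeff p (k + 1) =
      ∑ j ∈ Finset.range (k + 1),
        funEqCoeff p j * MvPolynomial.expand (p ^ (j + 1)) (logCoeff p (k - j)) := by
  rw [Finset.sum_range_succ, Nat.sub_self, logCoeff_zero, map_one, mul_one]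
  conv_rhs => rw [funEqCoeff]
  rw [Finset.sum_range]
  ring

theorem natCast_ne_zero_K : (p : MvPolynomial ℕ ℚ_[p]) ≠ 0 :=
  Nat.cast_ne_zero.mpr (Fact.out : p.Prime).ne_zero

/-- For Hazewinkel's generators the coefficients of the functional equation would be the `v_i`
themselves. For Araki's they differ from `v_{k+1}` by terms in which a large power of `p` multiplies
each `ℓ`, which makes integrality visible. -/
theorem funEqCoeff_eq (k : ℕ) :
    funEqCoeff p k = (p : MvPolynomial ℕ ℚ_[p]) ^ p ^ (k + 1) * logCoeff p (k + 1) +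
      MvPolynomial.X k - ∑ j ∈ Finset.range k, funEqCoeff p j *
        MvPolynomial.expand (p ^ (j + 1))
          ((p : MvPolynomial ℕ ℚ_[p]) ^ (p ^ (k - j) - 1) * logCoeff p (k - j)) := by
  have hp := (Fact.out : p.Prime)
  apply mul_left_cancel₀ (natCast_ne_zero_K p)
  have e1 : ∀ m : ℕ, (p : MvPolynomial ℕ ℚ_[p]) * (p : MvPolynomial ℕ ℚ_[p]) ^ (p ^ m - 1) =
      (p : MvPolynomial ℕ ℚ_[p]) ^ p ^ m := fun m => by
    rw [← pow_succ', Nat.sub_add_cancel (Nat.one_le_pow _ _ hp.pos)]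
  -- Here the functional equation is inserted into the Araki relation; in `hB` the Araki relation is
  -- inserted into the functional equation. Both give the same double sum over a triangle, which
  -- cancels. The indices are written in terms of `j` and `m - j` to fit
  -- `Finset.sum_range_diag_flip`.
  have hA : (p : MvPolynomial ℕ ℚ_[p]) *
      ∑ i ∈ Finset.range (k + 1), logCoeff p i * MvPolynomial.X (k - i) ^ p ^ i =
      (p : MvPolynomial ℕ ℚ_[p]) * MvPolynomial.X k + ∑ m ∈ Finset.range k,
        ∑ j ∈ Finset.range (m + 1), funEqCoeff p j *
          MvPolynomial.expand (p ^ (j + 1)) (logCoeff p (m - j)) *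
          MvPolynomial.X (k - 1 - j - (m - j)) ^ p ^ (m - j + (j + 1)) := by
    rw [Finset.sum_range_succ', mul_add, add_comm, logCoeff_zero, one_mul, pow_zero, pow_one,
      Nat.sub_zero, Finset.mul_sum]
    congr 1
    refine Finset.sum_congr rfl fun m _ => ?_
    rw [← mul_assoc, natCast_mul_logCoeff_succ_eq_sum_funEqCoeff, Finset.sum_mul]
    refine Finset.sum_congr rfl fun j hj => ?_
    have hj := Finset.mem_range.mp hj
    rw [show k - 1 - j - (m - j) = k - (m + 1) by omega, show m - j + (j + 1) = m + 1 by omega]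
  rw [Finset.sum_range_diag_flip k fun j i => funEqCoeff p j *
          MvPolynomial.expand (p ^ (j + 1)) (logCoeff p i) *
          MvPolynomial.X (k - 1 - j - i) ^ p ^ (i + (j + 1))] at hA
  have hB : (p : MvPolynomial ℕ ℚ_[p]) * ∑ j ∈ Finset.range k,
        funEqCoeff p j * MvPolynomial.expand (p ^ (j + 1)) (logCoeff p (k - j)) =
      (p : MvPolynomial ℕ ℚ_[p]) * (∑ j ∈ Finset.range k, funEqCoeff p j *
        MvPolynomial.expand (p ^ (j + 1))
          ((p : MvPolynomial ℕ ℚ_[p]) ^ (p ^ (k - j) - 1) * logCoeff p (k - j))) +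
      ∑ j ∈ Finset.range k, ∑ i ∈ Finset.range (k - j), funEqCoeff p j *
          MvPolynomial.expand (p ^ (j + 1)) (logCoeff p i) *
          MvPolynomial.X (k - 1 - j - i) ^ p ^ (i + (j + 1)) := by
    rw [Finset.mul_sum, Finset.mul_sum, ← Finset.sum_add_distrib]
    refine Finset.sum_congr rfl fun j hj => ?_
    have hj := Finset.mem_range.mp hj
    obtain ⟨m, hm⟩ : ∃ m, k - j = m + 1 := ⟨k - j - 1, by omega⟩
    have h := congrArg (MvPolynomial.expand (p ^ (j + 1))) (natCast_mul_logCoeff_succ p m)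
    simp only [map_mul, map_add, map_natCast, map_pow, map_sum, MvPolynomial.expand_X] at h
    rw [hm]
    simp only [map_mul, map_natCast, map_pow]
    have h2 := e1 (m + 1)
    have h3 : ∑ i ∈ Finset.range (m + 1), funEqCoeff p j *
          MvPolynomial.expand (p ^ (j + 1)) (logCoeff p i) *
          MvPolynomial.X (k - 1 - j - i) ^ p ^ (i + (j + 1)) = funEqCoeff p j *
        ∑ i ∈ Finset.range (m + 1), MvPolynomial.expand (p ^ (j + 1)) (logCoeff p i) *
          (MvPolynomial.X (m - i) ^ p ^ (j + 1)) ^ p ^ i := by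
      rw [Finset.mul_sum]
      refine Finset.sum_congr rfl fun i _ => ?_
      rw [← pow_mul, ← pow_add, add_comm (j + 1) i, mul_assoc,
        show k - 1 - j - i = m - i by omega]
    rw [h3]
    linear_combination funEqCoeff p j * h - funEqCoeff p j *
      MvPolynomial.expand (p ^ (j + 1)) (logCoeff p (m + 1)) * h2
  have hC : (p : MvPolynomial ℕ ℚ_[p]) * funEqCoeff p k = (p : MvPolynomial ℕ ℚ_[p]) *
      ((p : MvPolynomial ℕ ℚ_[p]) * logCoeff p (k + 1)) - (p : MvPolynomial ℕ ℚ_[p]) *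
      ∑ j ∈ Finset.range k,
        funEqCoeff p j * MvPolynomial.expand (p ^ (j + 1)) (logCoeff p (k - j)) := by
    conv_lhs => rw [funEqCoeff]
    rw [mul_sub, Finset.sum_range]
  rw [hC, hB, natCast_mul_logCoeff_succ, mul_add, hA]
  ring

/-- The denominator of `ℓ_m` divides `p^m`, and the exponents `p^m` and `p^m - 1` occurring in
`funEqCoeff_eq` are at least `m`. -/
theorem funEqCoeff_mem (k : ℕ) : funEqCoeff p k ∈ integralSubring p := by
  have hp := (Fact.out : p.Prime)
  have key : ∀ m e : ℕ, m ≤ e →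
      (p : MvPolynomial ℕ ℚ_[p]) ^ e * logCoeff p m ∈ integralSubring p := fun m e h => by
    rw [← Nat.sub_add_cancel h, pow_add, mul_assoc]
    exact mul_mem (pow_mem (natCast_mem _ _) _) (natCast_pow_mul_logCoeff_mem p m)
  induction k using Nat.strong_induction_on with
  | _ k ih =>
    rw [funEqCoeff_eq]
    refine sub_mem (add_mem (key _ _ (Nat.lt_pow_self hp.one_lt).le)
      (X_mem_integralSubring p k)) (sum_mem fun j hj => ?_)
    have hj := Finset.mem_range.mp hj
    refine mul_mem (ih j hj) (expand_mem_integralSubring p (key _ _ ?_) _)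
    have := Nat.lt_pow_self hp.one_lt (n := k - j)
    omega

end Integrality

end TateHonda


/-! ### Low-degree coefficients of powers of series -/

namespace MvPowerSeries

variable {R τ : Type*} [CommRing R]

theorem coeff_pow_eq_zero_of_degree_lt {f : MvPowerSeries τ R} (hf : f.constantCoeff = 0)
    {d : τ →₀ ℕ} {k : ℕ} (h : d.degree < k) : coeff d (f ^ k) = 0 :=
  coeff_of_lt_order (lt_of_lt_of_le (by exact_mod_cast h)
    (le_order_pow_of_constantCoeff_eq_zero k hf))

/-- The difference `f^k - g^k` is `f - g`, of order at least `m`, times a cofactor that has no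
constant term once `k ≥ 2`. So one more degree of agreement is gained. -/
theorem coeff_pow_sub_pow_eq_zero {f g : MvPowerSeries τ R} (hf : f.constantCoeff = 0)
    (hg : g.constantCoeff = 0) {m : ℕ} (h : ∀ d : τ →₀ ℕ, d.degree < m → coeff d f = coeff d g)
    {k : ℕ} (hk : 2 ≤ k) {d : τ →₀ ℕ} (hd : d.degree ≤ m) :
    coeff d (f ^ k) = coeff d (g ^ k) := by
  obtain ⟨k, rfl⟩ : ∃ l, k = l + 2 := ⟨k - 2, by omega⟩
  obtain ⟨w, hw⟩ := sub_dvd_pow_sub_pow f g (k + 1)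
  have e : f ^ (k + 2) - g ^ (k + 2) = (f - g) * (f ^ (k + 1) + w * g) := by
    linear_combination g * hw
  have h1 : (m : ℕ∞) ≤ (f - g).order := nat_le_order fun d hd => by rw [map_sub, h d hd, sub_self]
  have h2 : 1 ≤ (f ^ (k + 1) + w * g).order := by
    rw [one_le_order_iff_constCoeff_eq_zero]
    simp [hf, hg]
  rw [← sub_eq_zero, ← map_sub, e]
  refine coeff_of_lt_order (lt_of_lt_of_le ?_ ((add_le_add h1 h2).trans le_order_mul))
  exact_mod_cast Nat.lt_succ_of_le hd

theorem natCast_dvd_of_forall_coeff {n : ℕ} {f : MvPowerSeries τ R}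
    (h : ∀ d, (n : R) ∣ coeff d f) : (n : MvPowerSeries τ R) ∣ f := by
  choose c hc using h
  let g : MvPowerSeries τ R := fun d => c d
  refine ⟨g, ?_⟩
  ext d
  rw [hc d, ← map_natCast (C (σ := τ) (R := R)), coeff_C_mul]
  rfl

end MvPowerSeries

/-! ### The functional equation lemma -/

namespace TateHonda

open FormalGroup

section PTypical

variable (p : ℕ)

open Classical in
/-- The series `∑_k a_k t^{p^k}`. -/
noncomputable def pTypical {R : Type*} [CommRing R] (a : ℕ → R) : PowerSeries R :=
  PowerSeries.mk fun m => if m = p ^ Nat.log p m then a (Nat.log p m) else 0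

theorem coeff_pTypical_of_ne {R : Type*} [CommRing R] (a : ℕ → R) {m : ℕ}
    (h : ∀ k, m ≠ p ^ k) : PowerSeries.coeff m (pTypical p a) = 0 := by
  rw [pTypical, PowerSeries.coeff_mk, if_neg (h _)]

theorem map_pTypical {R S : Type*} [CommRing R] [CommRing S] (f : R →+* S) (a : ℕ → R) :
    PowerSeries.map f (pTypical p a) = pTypical p fun k => f (a k) := by
  ext m
  rw [PowerSeries.coeff_map, pTypical, pTypical, PowerSeries.coeff_mk, PowerSeries.coeff_mk]
  split_ifs <;> simp

end PTypical

section Integrality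

variable (p : ℕ) [Fact p.Prime]

theorem log_eq_pTypical : log p = pTypical p (logCoeff p) := rfl

theorem coeff_pTypical_pow {R : Type*} [CommRing R] (a : ℕ → R) (k : ℕ) :
    PowerSeries.coeff (p ^ k) (pTypical p a) = a k := by
  rw [pTypical, PowerSeries.coeff_mk, Nat.log_pow (Fact.out : p.Prime).one_lt, if_pos rfl]

/-- Since `f^{p^k}` has order at least `p^k > k`, the sum may stop at any bound not below the
degree. -/
theorem coeff_subst_pTypical {R τ : Type*} [CommRing R] (a : ℕ → R) {f : MvPowerSeries τ R}
    (hf : f.constantCoeff = 0) (d : τ →₀ ℕ) {M : ℕ} (hM : d.degree ≤ M) :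
    MvPowerSeries.coeff d (PowerSeries.subst f (pTypical p a)) =
      ∑ k ∈ Finset.range (M + 1), a k * MvPowerSeries.coeff d (f ^ p ^ k) := by
  classical
  have hp := (Fact.out : p.Prime)
  rw [PowerSeries.coeff_subst (.of_constantCoeff_zero hf),
    finsum_eq_sum_of_support_subset (s := (Finset.range (M + 1)).image (p ^ ·)),
    Finset.sum_image fun i _ j _ h => Nat.pow_right_injective hp.two_le h]
  · exact Finset.sum_congr rfl fun k _ => by rw [coeff_pTypical_pow, smul_eq_mul]
  · intro m hm
    rw [Function.mem_support] at hm
    by_cases h : ∃ k, m = p ^ k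
    · obtain ⟨k, rfl⟩ := h
      refine Finset.mem_coe.mpr (Finset.mem_image_of_mem _ (Finset.mem_range.mpr ?_))
      by_contra hk
      refine hm ?_
      rw [MvPowerSeries.coeff_pow_eq_zero_of_degree_lt hf, smul_zero]
      have := Nat.lt_pow_self hp.one_lt (n := k)
      omega
    · push Not at h
      exact absurd (by rw [coeff_pTypical_of_ne p a h, zero_smul]) hm

variable {τ : Type*}

/-- The lift `σ^j` of the `p^j`-power map: `v_i ↦ v_i^{p^j}` on coefficients, `x ↦ x^{p^j}` on the
variables. -/
noncomputable def frobLift {R : Type*} [CommRing R] (j : ℕ) :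
    MvPowerSeries τ (MvPolynomial ℕ R) →+* MvPowerSeries τ (MvPolynomial ℕ R) :=
  (MvPowerSeries.map (MvPolynomial.expand (p ^ j) : MvPolynomial ℕ R →ₐ[R] _).toRingHom).comp
    (MvPowerSeries.expand (p ^ j) (pow_ne_zero j (Fact.out : p.Prime).ne_zero)).toRingHom

theorem frobLift_apply {R : Type*} [CommRing R] (j : ℕ)
    (f : MvPowerSeries τ (MvPolynomial ℕ R)) :
    frobLift p j f = MvPowerSeries.map
      (MvPolynomial.expand (p ^ j) : MvPolynomial ℕ R →ₐ[R] _).toRingHom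
        (MvPowerSeries.expand (p ^ j) (pow_ne_zero j (Fact.out : p.Prime).ne_zero) f) := rfl

theorem map_frobLift {R S : Type*} [CommRing R] [CommRing S] (j : ℕ) (h : R →+* S)
    (f : MvPowerSeries τ (MvPolynomial ℕ R)) :
    MvPowerSeries.map (MvPolynomial.map h) (frobLift p j f) =
      frobLift p j (MvPowerSeries.map (MvPolynomial.map h) f) := by
  rw [frobLift_apply, frobLift_apply, ← MvPowerSeries.map_expand, MvPowerSeries.map_map,
    MvPowerSeries.map_map]
  congr 2
  ext x <;> simp

theorem constantCoeff_frobLift {R : Type*} [CommRing R] (j : ℕ)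
    {f : MvPowerSeries τ (MvPolynomial ℕ R)} (hf : f.constantCoeff = 0) :
    (frobLift p j f).constantCoeff = 0 := by
  rw [frobLift_apply, MvPowerSeries.constantCoeff_map, MvPowerSeries.constantCoeff_expand, hf,
    map_zero]

theorem order_frobLift {R : Type*} [CommRing R] (j : ℕ)
    (f : MvPowerSeries τ (MvPolynomial ℕ R)) : p ^ j • f.order ≤ (frobLift p j f).order := by
  rw [frobLift_apply, ← MvPowerSeries.order_expand]
  exact MvPowerSeries.le_order_map _

theorem frobLift_subst {R : Type*} [CommRing R] (j : ℕ)
    {f : MvPowerSeries τ (MvPolynomial ℕ R)} (hf : f.constantCoeff = 0)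
    (P : PowerSeries (MvPolynomial ℕ R)) :
    frobLift p j (PowerSeries.subst f P) = PowerSeries.subst (frobLift p j f)
      (PowerSeries.map (MvPolynomial.expand (p ^ j) : MvPolynomial ℕ R →ₐ[R] _).toRingHom P) := by
  have h : PowerSeries.HasSubst (MvPowerSeries.expand (p ^ j)
      (pow_ne_zero j (Fact.out : p.Prime).ne_zero) f) :=
    .of_constantCoeff_zero (by rw [MvPowerSeries.constantCoeff_expand, hf])
  rw [frobLift_apply, frobLift_apply, ← PowerSeries.map_subst h, PowerSeries.subst,
    MvPowerSeries.expand_subst _ _ (PowerSeries.HasSubst.of_constantCoeff_zero hf).const]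
  rfl

/-- Modulo `p` the coefficients lie in `𝔽_p[v₁, v₂, …]`. Frobenius is trivial on `𝔽_p`, so raising
all `v_i` and all variables to the power `p^j` is the same as taking `p^j`-th powers. -/
theorem natCast_dvd_pow_sub_frobLift (j : ℕ) (f : MvPowerSeries τ (MvPolynomial ℕ ℤ_[p])) :
    (p : MvPowerSeries τ (MvPolynomial ℕ ℤ_[p])) ∣ f ^ p ^ j - frobLift p j f := by
  have hp := (Fact.out : p.Prime)
  have hz : ∀ r : ℤ_[p], PadicInt.toZMod r = 0 ↔ (p : ℤ_[p]) ∣ r := fun r => by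
    rw [← RingHom.mem_ker, PadicInt.ker_toZMod, PadicInt.maximalIdeal_eq_span_p,
      Ideal.mem_span_singleton]
  have key : MvPowerSeries.map (MvPolynomial.map PadicInt.toZMod) (f ^ p ^ j) =
      MvPowerSeries.map (MvPolynomial.map PadicInt.toZMod) (frobLift p j f) := by
    rw [map_frobLift, map_pow, ← MvPowerSeries.map_iterateFrobenius_expand p hp.ne_zero,
      frobLift_apply]
    congr 2
    refine RingHom.ext fun x => ?_
    rw [iterateFrobenius_def, ← MvPolynomial.map_iterateFrobenius_expand p,
      Subsingleton.elim (iterateFrobenius (ZMod p) p j) (RingHom.id _), MvPolynomial.map_id]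
    rfl
  refine MvPowerSeries.natCast_dvd_of_forall_coeff fun d => ?_
  rw [← map_natCast MvPolynomial.C, MvPolynomial.C_dvd_iff_map_hom_eq_zero PadicInt.toZMod _ hz,
    map_sub, map_sub, sub_eq_zero, ← MvPowerSeries.coeff_map, ← MvPowerSeries.coeff_map, key]

/-- The operator `Q ↦ Q - ∑_{j ≥ 1} (h_j / p) σ^j(Q)`, multiplied by `p`, in degree `d`. -/
noncomputable def funEqOp (d : τ →₀ ℕ) :
    MvPowerSeries τ (MvPolynomial ℕ ℚ_[p]) →+ MvPolynomial ℕ ℚ_[p] where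
  toFun Q := (p : MvPolynomial ℕ ℚ_[p]) * MvPowerSeries.coeff d Q -
    ∑ j ∈ Finset.range d.degree, funEqCoeff p j * MvPowerSeries.coeff d (frobLift p (j + 1) Q)
  map_zero' := by simp
  map_add' f g := by
    simp only [map_add, mul_add, Finset.sum_add_distrib]
    ring

theorem funEqOp_apply (d : τ →₀ ℕ) (Q : MvPowerSeries τ (MvPolynomial ℕ ℚ_[p])) :
    funEqOp p d Q = (p : MvPolynomial ℕ ℚ_[p]) * MvPowerSeries.coeff d Q -
      ∑ j ∈ Finset.range d.degree,
        funEqCoeff p j * MvPowerSeries.coeff d (frobLift p (j + 1) Q) := rfl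

/-- Each `σ^{j+1}` multiplies the order by at least `p^{j+1} > 1`, so the twisted terms have no part
in degree `d`; this needs the degree to be positive. -/
theorem funEqOp_of_order {d : τ →₀ ℕ} (hd : d ≠ 0) {Q : MvPowerSeries τ (MvPolynomial ℕ ℚ_[p])}
    (h : (d.degree : ℕ∞) ≤ Q.order) :
    funEqOp p d Q = (p : MvPolynomial ℕ ℚ_[p]) * MvPowerSeries.coeff d Q := by
  have hp := (Fact.out : p.Prime)
  rw [funEqOp_apply, Finset.sum_eq_zero, sub_zero]
  intro j _
  rw [MvPowerSeries.coeff_of_lt_order, mul_zero]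
  refine lt_of_lt_of_le ?_ (order_frobLift p (j + 1) Q)
  refine lt_of_lt_of_le ?_ (nsmul_le_nsmul_right h (p ^ (j + 1)))
  rw [nsmul_eq_mul]
  have h1 : 0 < d.degree := Nat.pos_of_ne_zero fun h => hd ((Finsupp.degree_eq_zero_iff d).mp h)
  have h2 := Nat.one_lt_pow (n := j + 1) (by omega) hp.one_lt
  exact_mod_cast (by nlinarith : d.degree < p ^ (j + 1) * d.degree)

/-- Hazewinkel's functional equation lemma: `L(f)` satisfies the functional equation up to
integral terms if `f` is integral. -/
theorem funEqOp_log_subst_mem {f : MvPowerSeries τ (MvPolynomial ℕ ℤ_[p])}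
    (hf : f.constantCoeff = 0) (d : τ →₀ ℕ) :
    ∃ x ∈ integralSubring p, funEqOp p d (PowerSeries.subst (f.map (toK p)) (log p)) =
      (p : MvPolynomial ℕ ℚ_[p]) * x := by
  have hp := (Fact.out : p.Prime)
  set F := f.map (toK p) with hF
  set M := d.degree with hM
  have hF0 : F.constantCoeff = 0 := by rw [hF, MvPowerSeries.constantCoeff_map, hf, map_zero]
  set c : ℕ → MvPolynomial ℕ ℚ_[p] := fun k => MvPowerSeries.coeff d (F ^ p ^ k) with hc
  have hc0 : ∀ k, M < k → c k = 0 := fun k hk =>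
    MvPowerSeries.coeff_pow_eq_zero_of_degree_lt hF0 (hk.trans (Nat.lt_pow_self hp.one_lt))
  -- The functional equation rewrites `p ℓ_{k+1}` for each `k`. The inner range is then enlarged to
  -- a bound independent of `j`, which is harmless because the added powers of `F` vanish in degree
  -- `d`.
  have h1 : (p : MvPolynomial ℕ ℚ_[p]) * MvPowerSeries.coeff d (PowerSeries.subst F (log p)) =
      (p : MvPolynomial ℕ ℚ_[p]) * c 0 + ∑ j ∈ Finset.range M, ∑ i ∈ Finset.range (M + 1),
        funEqCoeff p j * MvPolynomial.expand (p ^ (j + 1)) (logCoeff p i) * c (i + (j + 1)) := by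
    rw [log_eq_pTypical, coeff_subst_pTypical p _ hF0 d le_rfl, Finset.sum_range_succ',
      logCoeff_zero, one_mul, mul_add, add_comm, Finset.mul_sum]
    congr 1
    have e1 : ∀ j ∈ Finset.range M, ∑ i ∈ Finset.range (M + 1),
        funEqCoeff p j * MvPolynomial.expand (p ^ (j + 1)) (logCoeff p i) * c (i + (j + 1)) =
        ∑ i ∈ Finset.range (M - j), funEqCoeff p j *
          MvPolynomial.expand (p ^ (j + 1)) (logCoeff p i) * c (i + (j + 1)) := fun j hj => by
      refine (Finset.sum_subset (Finset.range_subset_range.mpr (by omega)) fun i _ hi => ?_).symm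
      have := Finset.mem_range.not.mp hi
      rw [hc0 _ (by omega), mul_zero]
    rw [Finset.sum_congr rfl e1, ← Finset.sum_range_diag_flip M fun j i => funEqCoeff p j *
          MvPolynomial.expand (p ^ (j + 1)) (logCoeff p i) * c (i + (j + 1))]
    refine Finset.sum_congr rfl fun k _ => ?_
    rw [← mul_assoc, natCast_mul_logCoeff_succ_eq_sum_funEqCoeff, Finset.sum_mul]
    refine Finset.sum_congr rfl fun j hj => ?_
    have := Finset.mem_range.mp hj
    rw [show k - j + (j + 1) = k + 1 by omega]
  have h2 : ∀ j, MvPowerSeries.coeff d (frobLift p (j + 1) (PowerSeries.subst F (log p))) =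
      ∑ i ∈ Finset.range (M + 1), MvPolynomial.expand (p ^ (j + 1)) (logCoeff p i) *
        MvPowerSeries.coeff d (frobLift p (j + 1) F ^ p ^ i) := fun j => by
    rw [frobLift_subst p _ hF0, log_eq_pTypical, map_pTypical,
      coeff_subst_pTypical p _ (constantCoeff_frobLift p _ hF0) d le_rfl]
    rfl
  -- A congruence modulo `p` becomes one modulo `p^{i+1}` after taking `p^i`-th powers. Of these
  -- factors `p^i` clears the denominator of `ℓ_i`, and the remaining `p` is the one asserted.
  have h3 : ∀ i j, ∃ y ∈ integralSubring p, c (i + (j + 1)) -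
      MvPowerSeries.coeff d (frobLift p (j + 1) F ^ p ^ i) =
        (p : MvPolynomial ℕ ℚ_[p]) ^ (i + 1) * y := fun i j => by
    obtain ⟨g, hg⟩ := dvd_sub_pow_of_dvd_sub (natCast_dvd_pow_sub_frobLift p (j + 1) f) i
    refine ⟨toK p (MvPowerSeries.coeff d g), ⟨_, rfl⟩, ?_⟩
    have := congrArg (fun q => toK p (MvPowerSeries.coeff d q)) hg
    simp only [← MvPowerSeries.coeff_map, map_sub, map_mul, map_pow, map_natCast,
      map_frobLift] at this
    rw [← hF, ← pow_mul, ← pow_add, add_comm (j + 1) i] at this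
    change MvPowerSeries.coeff d (F ^ p ^ (i + (j + 1))) - _ = _
    rw [this, ← map_natCast (MvPowerSeries.C (σ := τ) (R := MvPolynomial ℕ ℚ_[p])), ← map_pow,
      MvPowerSeries.coeff_C_mul, MvPowerSeries.coeff_map]
  choose y hy hy' using h3
  refine ⟨c 0 + ∑ j ∈ Finset.range M, ∑ i ∈ Finset.range (M + 1), funEqCoeff p j *
    MvPolynomial.expand (p ^ (j + 1)) ((p : MvPolynomial ℕ ℚ_[p]) ^ i * logCoeff p i) * y i j,
    add_mem ?_ (sum_mem fun j _ => sum_mem fun i _ => mul_mem (mul_mem (funEqCoeff_mem p j)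
      (expand_mem_integralSubring p (natCast_pow_mul_logCoeff_mem p i) _)) (hy i j)), ?_⟩
  · rw [hc]
    simp only [pow_zero, pow_one]
    rw [hF, MvPowerSeries.coeff_map]
    exact ⟨_, rfl⟩
  · rw [funEqOp_apply, h1, mul_add, add_sub_assoc, ← Finset.sum_sub_distrib, Finset.mul_sum]
    congr 1
    refine Finset.sum_congr rfl fun j _ => ?_
    rw [h2, Finset.mul_sum, Finset.mul_sum, ← Finset.sum_sub_distrib]
    refine Finset.sum_congr rfl fun i _ => ?_
    simp only [map_mul, map_pow, map_natCast]
    linear_combination funEqCoeff p j * MvPolynomial.expand (p ^ (j + 1)) (logCoeff p i) * hy' i j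

/-- If `L(g) = L(u) + L(v)` with `u`, `v` integral, then `g` is integral. -/
theorem coeff_mem_integralSubring_of_log_eq {u v : MvPowerSeries τ (MvPolynomial ℕ ℤ_[p])}
    (hu : u.constantCoeff = 0) (hv : v.constantCoeff = 0)
    {g : MvPowerSeries τ (MvPolynomial ℕ ℚ_[p])} (hg : g.constantCoeff = 0)
    (h : PowerSeries.subst g (log p) = PowerSeries.subst (u.map (toK p)) (log p) +
      PowerSeries.subst (v.map (toK p)) (log p)) (d : τ →₀ ℕ) :
    MvPowerSeries.coeff d g ∈ integralSubring p := by
  classical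
  have hp := (Fact.out : p.Prime)
  induction hm : d.degree using Nat.strong_induction_on generalizing d with
  | _ m ih =>
    by_cases hd : d = 0
    · rw [hd, MvPowerSeries.coeff_zero_eq_constantCoeff_apply, hg]
      exact zero_mem _
    -- By induction the truncation of `g` below degree `m` lifts to an integral series `f`. In
    -- degrees up to `m`, the difference of `L(g)` and `L(f)` is just `g - f`.
    have ih' : ∀ e : τ →₀ ℕ, ∃ x : MvPolynomial ℕ ℤ_[p],
        toK p x = if e.degree < m then MvPowerSeries.coeff e g else 0 := fun e => by
      split_ifs with he
      · exact ih _ he e rfl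
      · exact ⟨0, map_zero _⟩
    choose c hc using ih'
    let f : MvPowerSeries τ (MvPolynomial ℕ ℤ_[p]) := fun e => c e
    have hf : ∀ e, MvPowerSeries.coeff e (f.map (toK p)) =
        if e.degree < m then MvPowerSeries.coeff e g else 0 := fun e => by
      rw [MvPowerSeries.coeff_map]
      exact hc e
    have hfK0 : (f.map (toK p)).constantCoeff = 0 := by
      rw [← MvPowerSeries.coeff_zero_eq_constantCoeff_apply, hf]
      simp [hg]
    have hf0 : f.constantCoeff = 0 := by
      apply toK_injective p
      rw [map_zero, ← hfK0, MvPowerSeries.constantCoeff_map]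
    have hlt : ∀ e : τ →₀ ℕ, e.degree < m →
        MvPowerSeries.coeff e g = MvPowerSeries.coeff e (f.map (toK p)) := fun e he => by
      rw [hf, if_pos he]
    have hcoeff : ∀ e : τ →₀ ℕ, e.degree ≤ m → MvPowerSeries.coeff e
        (PowerSeries.subst g (log p) - PowerSeries.subst (f.map (toK p)) (log p)) =
        MvPowerSeries.coeff e g - MvPowerSeries.coeff e (f.map (toK p)) := fun e he => by
      rw [map_sub, log_eq_pTypical, coeff_subst_pTypical p _ hg e le_rfl,
        coeff_subst_pTypical p _ hfK0 e le_rfl, Finset.sum_range_succ', Finset.sum_range_succ',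
        logCoeff_zero, pow_zero, pow_one, pow_one, one_mul, one_mul, add_sub_add_comm,
        sub_eq_zero_of_eq, _root_.zero_add]
      refine Finset.sum_congr rfl fun k _ => ?_
      rw [MvPowerSeries.coeff_pow_sub_pow_eq_zero hg hfK0 hlt _ he]
      exact hp.two_le.trans (Nat.le_self_pow (by omega) p)
    have hord : (d.degree : ℕ∞) ≤
        (PowerSeries.subst g (log p) - PowerSeries.subst (f.map (toK p)) (log p)).order :=
      MvPowerSeries.nat_le_order fun e he => by
        rw [hm] at he
        rw [hcoeff e he.le, hlt e he, sub_self]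
    -- On `L(g) - L(f)` the operator only sees `p` times the coefficient of `g` in degree `d`. On
    -- `L(u)`, `L(v)` and `L(f)` it takes values in `p` times integral elements, so `p` cancels.
    have key := funEqOp_of_order p hd hord
    rw [hcoeff d hm.le, hf, if_neg (by omega), sub_zero, h, map_sub, map_add] at key
    obtain ⟨x, hx, hx'⟩ := funEqOp_log_subst_mem p hu d
    obtain ⟨y, hy, hy'⟩ := funEqOp_log_subst_mem p hv d
    obtain ⟨z, hz, hz'⟩ := funEqOp_log_subst_mem p hf0 d
    rw [hx', hy', hz', ← mul_add, ← mul_sub] at key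
    rw [← mul_left_cancel₀ (natCast_ne_zero_K p) key]
    exact sub_mem (add_mem hx hy) hz

end Integrality

end TateHonda


/-! ### Logarithms of formal group laws -/

namespace FormalGroup

variable {R τ : Type*} [CommRing R]

/-- A series `G` with `P(G(s,t)) = P(s) + P(t)` is additive with respect to `P`. -/
theorem subst_pair_of_logarithm {P : PowerSeries R} {G : MvPowerSeries (Fin 2) R}
    (hG : G.constantCoeff = 0)
    (h : PowerSeries.subst G P =
      PowerSeries.subst (MvPowerSeries.X 0 : MvPowerSeries (Fin 2) R) P +
        PowerSeries.subst (MvPowerSeries.X 1 : MvPowerSeries (Fin 2) R) P)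
    {f g : MvPowerSeries τ R} (hf : PowerSeries.HasSubst f) (hg : PowerSeries.HasSubst g) :
    PowerSeries.subst (G.subst ![f, g]) P = PowerSeries.subst f P + PowerSeries.subst g P := by
  have hfg := hasSubst_pair hf hg
  have key : ∀ a : MvPowerSeries (Fin 2) R, PowerSeries.HasSubst a →
      MvPowerSeries.subst ![f, g] (PowerSeries.subst a P) =
        PowerSeries.subst (MvPowerSeries.subst ![f, g] a) P := fun a ha =>
    MvPowerSeries.subst_comp_subst_apply ha.const hfg P
  have h1 := congrArg (MvPowerSeries.subst ![f, g]) h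
  rw [MvPowerSeries.subst_add hfg, key _ (.of_constantCoeff_zero hG),
    key _ (PowerSeries.HasSubst.X 0), key _ (PowerSeries.HasSubst.X 1),
    MvPowerSeries.subst_X hfg, MvPowerSeries.subst_X hfg] at h1
  exact h1

theorem subst_injective_of_comp_eq_X {P Q : PowerSeries R} (hP : P.constantCoeff = 0)
    (h : comp Q P = PowerSeries.X) {f g : MvPowerSeries τ R} (hf : PowerSeries.HasSubst f)
    (hg : PowerSeries.HasSubst g) (hfg : PowerSeries.subst f P = PowerSeries.subst g P) :
    f = g := by
  have key : ∀ {a : MvPowerSeries τ R}, PowerSeries.HasSubst a →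
      PowerSeries.subst (PowerSeries.subst a P) Q = a := fun {a} ha => by
    rw [← PowerSeries.subst_comp_subst_apply (.of_constantCoeff_zero' hP) ha]
    change PowerSeries.subst a (comp Q P) = a
    rw [h, PowerSeries.subst_X ha]
  rw [← key hf, hfg, key hg]

/-- The logarithm of the series `[k]_F`. -/
theorem subst_nSeries_of_logarithm {P : PowerSeries R} (hP : P.constantCoeff = 0)
    (F : FormalGroup R) (h : PowerSeries.subst F.toPowerSeries P =
      PowerSeries.subst (MvPowerSeries.X 0 : MvPowerSeries (Fin 2) R) P +
        PowerSeries.subst (MvPowerSeries.X 1 : MvPowerSeries (Fin 2) R) P) (k : ℕ) :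
    comp P (F.nSeries k) = (k : PowerSeries R) * P := by
  induction k with
  | zero =>
    rw [nSeries_zero, Nat.cast_zero, zero_mul]
    exact PowerSeries.subst_zero_of_constantCoeff_zero hP
  | succ k ih =>
    rw [comp] at ih ⊢
    rw [nSeries_succ, subst_pair_of_logarithm F.zero_constantCoeff h
      (.of_constantCoeff_zero (F.constantCoeff_nSeries k)) PowerSeries.HasSubst.X', ih,
      Nat.cast_succ, add_mul, one_mul]
    exact congrArg _ (PowerSeries.X_subst P)

end FormalGroup

/-! ### Existence and commutativity of the law with the Araki logarithm -/

namespace TateHonda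

open FormalGroup

section Existence

variable (p : ℕ) [Fact p.Prime]

theorem constantCoeff_log : (log p).constantCoeff = 0 := by
  rw [← PowerSeries.coeff_zero_eq_constantCoeff_apply, log_eq_pTypical]
  exact coeff_pTypical_of_ne p _ fun k => (pow_ne_zero k (Fact.out : p.Prime).ne_zero).symm

theorem coeff_one_log : (log p).coeff 1 = 1 := by
  have := coeff_pTypical_pow p (logCoeff p) 0
  rwa [pow_zero, logCoeff_zero] at this

theorem isUnit_coeff_one_log : IsUnit ((log p).coeff 1) := by
  rw [coeff_one_log]; exact isUnit_one

/-- The compositional inverse of the logarithm. -/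
noncomputable def exp : PowerSeries (MvPolynomial ℕ ℚ_[p]) :=
  (log p).substInvOfIsUnit (isUnit_coeff_one_log p)

theorem constantCoeff_exp : (exp p).constantCoeff = 0 :=
  PowerSeries.constantCoeff_substInvOfIsUnit _ _

variable {p} {τ : Type*}

theorem log_subst_exp_subst {f : MvPowerSeries τ (MvPolynomial ℕ ℚ_[p])}
    (hf : PowerSeries.HasSubst f) :
    PowerSeries.subst (PowerSeries.subst f (exp p)) (log p) = f := by
  rw [← PowerSeries.subst_comp_subst_apply (.of_constantCoeff_zero' (constantCoeff_exp p)) hf, exp,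
    PowerSeries.subst_substInvOfIsUnit_right _ (constantCoeff_log p), PowerSeries.subst_X hf]

theorem comp_exp_log : comp (exp p) (log p) = PowerSeries.X :=
  PowerSeries.subst_substInvOfIsUnit_left _ (constantCoeff_log p) _

theorem log_subst_injective {f g : MvPowerSeries τ (MvPolynomial ℕ ℚ_[p])}
    (hf : PowerSeries.HasSubst f) (hg : PowerSeries.HasSubst g)
    (h : PowerSeries.subst f (log p) = PowerSeries.subst g (log p)) : f = g :=
  subst_injective_of_comp_eq_X (constantCoeff_log p) comp_exp_log hf hg h

theorem coeff_log_subst_of_degree_eq_one {f : MvPowerSeries τ (MvPolynomial ℕ ℚ_[p])}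
    (hf : f.constantCoeff = 0) {d : τ →₀ ℕ} (hd : d.degree = 1) :
    MvPowerSeries.coeff d (PowerSeries.subst f (log p)) = MvPowerSeries.coeff d f := by
  rw [log_eq_pTypical, coeff_subst_pTypical p _ hf d le_rfl, hd, Finset.sum_range_succ,
    Finset.sum_range_one, logCoeff_zero, pow_zero, pow_one, one_mul, pow_one,
    MvPowerSeries.coeff_pow_eq_zero_of_degree_lt hf, mul_zero, _root_.add_zero]
  rw [hd]
  exact (Fact.out : p.Prime).one_lt

variable (p)

/-- The law is `exp (log s + log t)`. Its coefficients are integral by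
`coeff_mem_integralSubring_of_log_eq` with `u = s` and `v = t`. Associativity can be tested over
`ℚ_p`, after applying the injective logarithm. -/
theorem exists_hasArakiLog : ∃ G, HasArakiLog p G := by
  let K := MvPolynomial ℕ ℚ_[p]
  let ℓ : MvPowerSeries (Fin 2) K := PowerSeries.subst (MvPowerSeries.X 0) (log p) +
      PowerSeries.subst (MvPowerSeries.X 1) (log p)
  have hX : ∀ i : Fin 2, (MvPowerSeries.X i : MvPowerSeries (Fin 2) K).constantCoeff = 0 :=
    fun i => MvPowerSeries.constantCoeff_X i
  have hℓ : ℓ.constantCoeff = 0 := by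
    rw [map_add, PowerSeries.constantCoeff_subst_eq_zero (hX 0) _ (constantCoeff_log p),
      PowerSeries.constantCoeff_subst_eq_zero (hX 1) _ (constantCoeff_log p), _root_.add_zero]
  let g : MvPowerSeries (Fin 2) K := PowerSeries.subst ℓ (exp p)
  have hg0 : g.constantCoeff = 0 :=
    PowerSeries.constantCoeff_subst_eq_zero hℓ _ (constantCoeff_exp p)
  have hg : PowerSeries.subst g (log p) = ℓ := log_subst_exp_subst (.of_constantCoeff_zero hℓ)
  have hint : ∀ d, MvPowerSeries.coeff d g ∈ integralSubring p := by
    refine coeff_mem_integralSubring_of_log_eq p (MvPowerSeries.constantCoeff_X 0)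
      (MvPowerSeries.constantCoeff_X 1) hg0 ?_
    rw [MvPowerSeries.map_X, MvPowerSeries.map_X]
    exact hg
  choose c hc using hint
  let G : MvPowerSeries (Fin 2) (MvPolynomial ℕ ℤ_[p]) := fun d => c d
  have hG : G.map (toK p) = g := by
    ext1 d
    rw [MvPowerSeries.coeff_map]
    exact hc d
  have hG0 : G.constantCoeff = 0 := by
    apply toK_injective p
    rw [map_zero, ← hg0, ← hG, MvPowerSeries.constantCoeff_map]
  have hlin : ∀ i : Fin 2, G.coeff (Finsupp.single i 1) = 1 := fun i => by
    apply toK_injective p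
    have hd : (Finsupp.single i 1 : Fin 2 →₀ ℕ).degree = 1 := Finsupp.degree_single i 1
    rw [map_one, ← MvPowerSeries.coeff_map, hG, ← coeff_log_subst_of_degree_eq_one hg0 hd, hg,
      map_add, coeff_log_subst_of_degree_eq_one (hX 0) hd,
      coeff_log_subst_of_degree_eq_one (hX 1) hd, MvPowerSeries.coeff_index_single_X,
      MvPowerSeries.coeff_index_single_X]
    fin_cases i <;> simp
  have hmapinj : Function.Injective (MvPowerSeries.map (σ := Fin 3) (toK p)) :=
    fun a b hab => by
      ext1 d
      apply toK_injective p
      rw [← MvPowerSeries.coeff_map, hab, MvPowerSeries.coeff_map]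
  have hS : ∀ {R : Type} [CommRing R] {G : MvPowerSeries (Fin 2) R} {a b : MvPowerSeries (Fin 3) R},
      G.constantCoeff = 0 → PowerSeries.HasSubst a → PowerSeries.HasSubst b →
      PowerSeries.HasSubst (G.subst ![a, b]) := fun hG ha hb =>
    MvPowerSeries.IsNilpotent_subst (hasSubst_pair ha hb) (by rw [hG]; exact IsNilpotent.zero)
  have hY : ∀ {R : Type} [CommRing R] (i : Fin 3),
      PowerSeries.HasSubst (MvPowerSeries.X i : MvPowerSeries (Fin 3) R) :=
    fun i => PowerSeries.HasSubst.X i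
  refine ⟨⟨G, hG0, hlin 0, hlin 1, hmapinj ?_⟩, ?_⟩
  · rw [map_subst_pair _ _ (hS hG0 (hY 0) (hY 1)) (hY 2),
      map_subst_pair _ _ (hY 0) (hS hG0 (hY 1) (hY 2)), map_subst_pair _ _ (hY 0) (hY 1),
      map_subst_pair _ _ (hY 1) (hY 2), hG]
    simp only [MvPowerSeries.map_X]
    have h01 := hS hg0 (hY 0) (hY 1)
    have h12 := hS hg0 (hY 1) (hY 2)
    refine log_subst_injective (hS hg0 h01 (hY 2)) (hS hg0 (hY 0) h12) ?_
    rw [subst_pair_of_logarithm hg0 hg h01 (hY 2), subst_pair_of_logarithm hg0 hg (hY 0) (hY 1),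
      subst_pair_of_logarithm hg0 hg (hY 0) h12, subst_pair_of_logarithm hg0 hg (hY 1) (hY 2), add_assoc]
  · change PowerSeries.subst (G.map (toK p)) (log p) = _
    rw [hG]
    exact hg

theorem hasArakiLog_bpLaw : HasArakiLog p (bpLaw p) := by
  rw [bpLaw, dif_pos (exists_hasArakiLog p)]
  exact (exists_hasArakiLog p).choose_spec

variable {p}

theorem log_subst_bpLaw {f g : MvPowerSeries τ (MvPolynomial ℕ ℚ_[p])}
    (hf : PowerSeries.HasSubst f) (hg : PowerSeries.HasSubst g) :
    PowerSeries.subst (((bpLaw p).map (toK p)).toPowerSeries.subst ![f, g]) (log p) =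
      PowerSeries.subst f (log p) + PowerSeries.subst g (log p) :=
  subst_pair_of_logarithm ((bpLaw p).map (toK p)).zero_constantCoeff (hasArakiLog_bpLaw p) hf hg

theorem map_toK_injective : Function.Injective (MvPowerSeries.map (σ := τ) (toK p)) :=
  fun a b hab => by
    ext1 d
    apply toK_injective p
    rw [← MvPowerSeries.coeff_map, hab, MvPowerSeries.coeff_map]

instance : (bpLaw p).IsComm where
  comm := by
    apply map_toK_injective
    rw [map_subst_pair _ _ (PowerSeries.HasSubst.X 1) (PowerSeries.HasSubst.X 0)]
    have h0 : PowerSeries.HasSubst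
      (MvPowerSeries.X 0 : MvPowerSeries (Fin 2) (MvPolynomial ℕ ℚ_[p])) := PowerSeries.HasSubst.X 0
    have h1 : PowerSeries.HasSubst
      (MvPowerSeries.X 1 : MvPowerSeries (Fin 2) (MvPolynomial ℕ ℚ_[p])) := PowerSeries.HasSubst.X 1
    simp only [MvPowerSeries.map_X]
    refine log_subst_injective ((bpLaw p).map (toK p)).hasSubst_toPowerSeries
      (hasSubst_subst_pair ((bpLaw p).map (toK p)) h1 h0) ?_
    refine (hasArakiLog_bpLaw p).trans ?_
    rw [add_comm]
    exact (log_subst_bpLaw h1 h0).symm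

end Existence

end TateHonda


/-! ### The Araki formula for the series `[p]` -/

namespace TateHonda

open FormalGroup

section PSeries

variable (p : ℕ) [Fact p.Prime]

theorem comp_C_mul_X_pow_pTypical {R : Type*} [CommRing R] (a : ℕ → R) (c : R) (j : ℕ) :
    comp (pTypical p a) (PowerSeries.C c * PowerSeries.X ^ p ^ j) =
      pTypical p fun s => if j ≤ s then a (s - j) * c ^ p ^ (s - j) else 0 := by
  have hp := (Fact.out : p.Prime)
  have hpj : 0 < p ^ j := Nat.pow_pos hp.pos
  have h0 : (PowerSeries.C c * PowerSeries.X ^ p ^ j : PowerSeries R).constantCoeff = 0 := by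
    simp [hp.ne_zero]
  have hpow : ∀ m d : ℕ, PowerSeries.coeff m
      ((PowerSeries.C c * PowerSeries.X ^ p ^ j : PowerSeries R) ^ d) =
        if m = p ^ j * d then c ^ d else 0 := fun m d => by
    rw [mul_pow, ← pow_mul, ← map_pow, PowerSeries.coeff_C_mul, PowerSeries.coeff_X_pow, mul_ite,
      mul_one, mul_zero]
  ext m
  rw [comp, PowerSeries.coeff_subst' (.of_constantCoeff_zero' h0)]
  simp only [hpow, smul_eq_mul]
  by_cases hm : ∃ d, m = p ^ j * d
  · obtain ⟨d, rfl⟩ := hm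
    rw [finsum_eq_single _ d fun e he => by
      rw [if_neg fun h => he (Nat.eq_of_mul_eq_mul_left hpj h).symm, mul_zero], if_pos rfl]
    by_cases hd : ∃ k, d = p ^ k
    · obtain ⟨k, rfl⟩ := hd
      rw [← pow_add, coeff_pTypical_pow, coeff_pTypical_pow, if_pos (Nat.le_add_right j k),
        Nat.add_sub_cancel_left]
    · push Not at hd
      rw [coeff_pTypical_of_ne p _ hd, zero_mul]
      by_cases hs : ∃ s, p ^ j * d = p ^ s
      · obtain ⟨s, hs⟩ := hs
        rw [hs, coeff_pTypical_pow, if_neg]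
        intro hjs
        refine hd (s - j) (Nat.eq_of_mul_eq_mul_left hpj ?_)
        rw [hs, ← pow_add, Nat.add_sub_cancel' hjs]
      · push Not at hs
        rw [coeff_pTypical_of_ne p _ hs]
  · push Not at hm
    rw [finsum_eq_zero_of_forall_eq_zero fun d => by rw [if_neg (hm d), mul_zero]]
    by_cases hs : ∃ s, m = p ^ s
    · obtain ⟨s, rfl⟩ := hs
      rw [coeff_pTypical_pow, if_neg]
      intro hjs
      refine hm (p ^ (s - j)) ?_
      rw [← pow_add, Nat.add_sub_cancel' hjs]
    · push Not at hs
      rw [coeff_pTypical_of_ne p _ hs]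

/-- The endomorphism `v_i ↦ 0` for `i ≠ a + 1, b + 1`. -/
noncomputable def killExcept (R : Type*) [CommRing R] (a b : ℕ) :
    MvPolynomial ℕ R →+* MvPolynomial ℕ R :=
  (MvPolynomial.aeval (R := R) fun j =>
    if j = a ∨ j = b then (MvPolynomial.X j : MvPolynomial ℕ R) else 0).toRingHom

theorem killExcept_X (R : Type*) [CommRing R] (a b j : ℕ) :
    killExcept R a b (MvPolynomial.X j) = if j = a ∨ j = b then MvPolynomial.X j else 0 := by
  simp [killExcept]

theorem killExcept_C (R : Type*) [CommRing R] (a b : ℕ) (r : R) :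
    killExcept R a b (MvPolynomial.C r) = MvPolynomial.C r := by
  simp [killExcept, MvPolynomial.algebraMap_eq]

theorem toK_comp_killExcept (a b : ℕ) :
    (toK p).comp (killExcept ℤ_[p] a b) = (killExcept ℚ_[p] a b).comp (toK p) := by
  refine MvPolynomial.ringHom_ext (fun r => ?_) fun j => ?_
  · simp [killExcept_C]
  · simp only [RingHom.comp_apply, killExcept_X, MvPolynomial.map_X]
    split_ifs <;> simp

/-- This is the Araki relation with only `v₀ = p`, `v_{a+1}` and `v_{b+1}` surviving. The three
terms are arranged as the coefficients at `t^{p^s}` of the logarithms of the three summands of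
`[p](t)`. -/
theorem natCast_mul_killExcept_logCoeff {a b : ℕ} (hab : a ≠ b) (s : ℕ) :
    (p : MvPolynomial ℕ ℚ_[p]) * killExcept ℚ_[p] a b (logCoeff p s) =
      killExcept ℚ_[p] a b (logCoeff p s) * (p : MvPolynomial ℕ ℚ_[p]) ^ p ^ s +
      (if a + 1 ≤ s then killExcept ℚ_[p] a b (logCoeff p (s - (a + 1))) *
        MvPolynomial.X a ^ p ^ (s - (a + 1)) else 0) +
      (if b + 1 ≤ s then killExcept ℚ_[p] a b (logCoeff p (s - (b + 1))) *
        MvPolynomial.X b ^ p ^ (s - (b + 1)) else 0) := by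
  have hp := (Fact.out : p.Prime)
  rcases s with _ | k
  · simp [logCoeff_zero]
  · have h := congrArg (killExcept ℚ_[p] a b) (natCast_mul_logCoeff_succ p k)
    simp only [map_mul, map_add, map_natCast, map_pow, map_sum, killExcept_X] at h
    have hsum : ∀ c : ℕ, ∑ i ∈ Finset.range (k + 1),
        (if k - i = c then killExcept ℚ_[p] a b (logCoeff p i) *
          (MvPolynomial.X c : MvPolynomial ℕ ℚ_[p]) ^ p ^ i else 0) =
        if c + 1 ≤ k + 1 then killExcept ℚ_[p] a b (logCoeff p (k + 1 - (c + 1))) *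
        MvPolynomial.X c ^ p ^ (k + 1 - (c + 1)) else 0 := fun c => by
      rw [Nat.add_sub_add_right]
      split_ifs with hc
      · rw [Finset.sum_eq_single (k - c), if_pos (by omega)]
        · intro i hi hne
          have := Finset.mem_range.mp hi
          rw [if_neg (by omega)]
        · intro hmem
          exact absurd (Finset.mem_range.mpr (by omega)) hmem
      · refine Finset.sum_eq_zero fun i hi => if_neg ?_
        omega
    rw [h, mul_comm, add_assoc, ← hsum, ← hsum, ← Finset.sum_add_distrib]
    congr 1
    refine Finset.sum_congr rfl fun i _ => ?_
    have hpi : p ^ i ≠ 0 := pow_ne_zero i hp.ne_zero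
    by_cases h1 : k - i = a
    · rw [if_pos (Or.inl h1), if_pos h1, if_neg (by omega), _root_.add_zero, h1]
    · by_cases h2 : k - i = b
      · rw [if_pos (Or.inr h2), if_neg h1, if_pos h2, _root_.zero_add, h2]
      · rw [if_neg (by tauto), if_neg h1, if_neg h2, zero_pow hpi, mul_zero, _root_.add_zero]

/-- The Araki formula `[p](t) = p t +_F v_{a+1} t^{p^{a+1}} +_F v_{b+1} t^{p^{b+1}}` when all other
generators vanish. -/
theorem nSeries_killExcept {a b : ℕ} (hab : a ≠ b) :
    ((bpLaw p).map (killExcept ℤ_[p] a b)).nSeries p =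
      ((bpLaw p).map (killExcept ℤ_[p] a b)).toPowerSeries.subst
        ![((bpLaw p).map (killExcept ℤ_[p] a b)).toPowerSeries.subst
          ![PowerSeries.C (p : MvPolynomial ℕ ℤ_[p]) * PowerSeries.X,
            PowerSeries.C (MvPolynomial.X a) * PowerSeries.X ^ p ^ (a + 1)],
          PowerSeries.C (MvPolynomial.X b) * PowerSeries.X ^ p ^ (b + 1)] := by
  have hp := (Fact.out : p.Prime)
  set κ := killExcept ℤ_[p] a b with hκ
  set κK := killExcept ℚ_[p] a b with hκK
  set F := (bpLaw p).map κ with hF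
  have hFK : F.map (toK p) = ((bpLaw p).map (toK p)).map κK := by
    rw [hF, map_map, map_map, hκ, hκK, toK_comp_killExcept]
  set L := PowerSeries.map κK (log p) with hL
  have hL0 : L.constantCoeff = 0 := by
    rw [hL, ← PowerSeries.coeff_zero_eq_constantCoeff_apply, PowerSeries.coeff_map,
      PowerSeries.coeff_zero_eq_constantCoeff_apply, constantCoeff_log, map_zero]
  have hLinv : comp (PowerSeries.map κK (exp p)) L = PowerSeries.X := by
    rw [hL, ← map_comp _ (constantCoeff_log p), comp_exp_log, PowerSeries.map_X]
  have hadd : PowerSeries.subst (F.map (toK p)).toPowerSeries L =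
      PowerSeries.subst (MvPowerSeries.X 0 : MvPowerSeries (Fin 2) (MvPolynomial ℕ ℚ_[p])) L +
        PowerSeries.subst (MvPowerSeries.X 1 : MvPowerSeries (Fin 2) (MvPolynomial ℕ ℚ_[p])) L := by
    have h := congrArg (MvPowerSeries.map κK) (hasArakiLog_bpLaw p)
    rw [map_add, PowerSeries.map_subst (PowerSeries.HasSubst.X 0),
      PowerSeries.map_subst (PowerSeries.HasSubst.X 1), MvPowerSeries.map_X, MvPowerSeries.map_X,
      PowerSeries.map_subst (hasSubst_toPowerSeries _)] at h
    rw [hFK]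
    exact h
  have hs : ∀ (c : MvPolynomial ℕ ℤ_[p]) (e : ℕ), PowerSeries.HasSubst
      (PowerSeries.C c * PowerSeries.X ^ p ^ e : PowerSeries (MvPolynomial ℕ ℤ_[p])) := fun c e =>
    .of_constantCoeff_zero' (by simp [hp.ne_zero])
  have hsK : ∀ (c : MvPolynomial ℕ ℚ_[p]) (e : ℕ), PowerSeries.HasSubst
      (PowerSeries.C c * PowerSeries.X ^ p ^ e : PowerSeries (MvPolynomial ℕ ℚ_[p])) := fun c e =>
    .of_constantCoeff_zero' (by simp [hp.ne_zero])
  have hmap : ∀ (c : MvPolynomial ℕ ℤ_[p]) (e : ℕ), MvPowerSeries.map (toK p)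
      (PowerSeries.C c * PowerSeries.X ^ p ^ e : PowerSeries (MvPolynomial ℕ ℤ_[p])) =
      (PowerSeries.C (toK p c) * PowerSeries.X ^ p ^ e :
        PowerSeries (MvPolynomial ℕ ℚ_[p])) := fun c e => by
    change PowerSeries.map (toK p) _ = _
    rw [_root_.map_mul, _root_.map_pow, PowerSeries.map_X, PowerSeries.map_C]
  -- Writing `t` as `t^{p^0}` gives all three summands the shape handled by
  -- `comp_C_mul_X_pow_pTypical`.
  have hX : (PowerSeries.C (p : MvPolynomial ℕ ℤ_[p]) * PowerSeries.X :
      PowerSeries (MvPolynomial ℕ ℤ_[p])) =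
      PowerSeries.C (p : MvPolynomial ℕ ℤ_[p]) * PowerSeries.X ^ p ^ 0 := by
    rw [pow_zero, pow_one]
  rw [hX]
  apply map_toK_injective (p := p)
  rw [map_subst_pair _ _ (hasSubst_subst_pair F (hs _ _) (hs _ _)) (hs _ _),
    map_subst_pair _ _ (hs _ _) (hs _ _), hmap, hmap, hmap]
  change PowerSeries.map (toK p) (F.nSeries p) =
    (F.map (toK p)).toPowerSeries.subst ![(F.map (toK p)).toPowerSeries.subst ![_, _], _]
  rw [← map_nSeries]
  -- It suffices to compare logarithms over `ℚ_p`, where formal sums become ordinary sums and `[p]`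
  -- becomes multiplication by `p`.
  refine subst_injective_of_comp_eq_X hL0 hLinv
    (.of_constantCoeff_zero (constantCoeff_nSeries _ _))
    (hasSubst_subst_pair _ (hasSubst_subst_pair _ (hsK _ _) (hsK _ _)) (hsK _ _)) ?_
  rw [subst_pair_of_logarithm (F.map (toK p)).zero_constantCoeff hadd
    (hasSubst_subst_pair _ (hsK _ _) (hsK _ _)) (hsK _ _),
    subst_pair_of_logarithm (F.map (toK p)).zero_constantCoeff hadd (hsK _ _) (hsK _ _)]
  change comp L _ = comp L _ + comp L _ + comp L _
  rw [subst_nSeries_of_logarithm hL0 _ hadd, hL, log_eq_pTypical, map_pTypical,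
    comp_C_mul_X_pow_pTypical, comp_C_mul_X_pow_pTypical, comp_C_mul_X_pow_pTypical,
    ← map_natCast (PowerSeries.C (R := MvPolynomial ℕ ℚ_[p]))]
  ext1 m
  rw [PowerSeries.coeff_C_mul, map_add, map_add]
  by_cases hm : ∃ s, m = p ^ s
  · obtain ⟨s, rfl⟩ := hm
    simp only [coeff_pTypical_pow, MvPolynomial.map_X, map_natCast]
    rw [natCast_mul_killExcept_logCoeff p hab, if_pos (Nat.zero_le s), Nat.sub_zero]
  · push Not at hm
    simp only [coeff_pTypical_of_ne p _ hm, mul_zero, _root_.add_zero]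

/-- In characteristic `p`, if only `v_{a+1}` and `v_{b+1}` are nonzero, then
`[p](t) = v_{a+1} t^{p^{a+1}} +_F v_{b+1} t^{p^{b+1}}`. -/
theorem nSeries_map_bpLaw {R : Type*} [CommRing R] [CharP R p] (ψ : MvPolynomial ℕ ℤ_[p] →+* R)
    {a b : ℕ} (hab : a ≠ b) (h : ∀ j, j ≠ a → j ≠ b → ψ (MvPolynomial.X j) = 0) :
    ((bpLaw p).map ψ).nSeries p = ((bpLaw p).map ψ).toPowerSeries.subst
      ![PowerSeries.C (ψ (MvPolynomial.X a)) * PowerSeries.X ^ p ^ (a + 1),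
        PowerSeries.C (ψ (MvPolynomial.X b)) * PowerSeries.X ^ p ^ (b + 1)] := by
  have hp := (Fact.out : p.Prime)
  -- The integral formula can therefore be pushed forward along `ψ`; its summand `p t` dies in
  -- characteristic `p`.
  have hψ : ψ.comp (killExcept ℤ_[p] a b) = ψ := by
    refine MvPolynomial.ringHom_ext (fun r => ?_) fun j => ?_
    · simp [killExcept_C]
    · rw [RingHom.comp_apply, killExcept_X]
      split_ifs with hj
      · rfl
      · rw [map_zero, h j (by tauto) (by tauto)]
  have hs : ∀ (c : MvPolynomial ℕ ℤ_[p]) (e : ℕ), PowerSeries.HasSubst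
      (PowerSeries.C c * PowerSeries.X ^ p ^ e : PowerSeries (MvPolynomial ℕ ℤ_[p])) := fun c e =>
    .of_constantCoeff_zero' (by simp [hp.ne_zero])
  have hs1 : PowerSeries.HasSubst (PowerSeries.C (p : MvPolynomial ℕ ℤ_[p]) * PowerSeries.X :
      PowerSeries (MvPolynomial ℕ ℤ_[p])) := .of_constantCoeff_zero' (by simp)
  have hsR : ∀ (c : R) (e : ℕ), PowerSeries.HasSubst
      (PowerSeries.C c * PowerSeries.X ^ p ^ e : PowerSeries R) := fun c e =>
    .of_constantCoeff_zero' (by simp [hp.ne_zero])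
  have hmap : ∀ (c : MvPolynomial ℕ ℤ_[p]) (e : ℕ), MvPowerSeries.map ψ
      (PowerSeries.C c * PowerSeries.X ^ p ^ e : PowerSeries (MvPolynomial ℕ ℤ_[p])) =
      (PowerSeries.C (ψ c) * PowerSeries.X ^ p ^ e : PowerSeries R) := fun c e => by
    change PowerSeries.map ψ _ = _
    rw [_root_.map_mul, _root_.map_pow, PowerSeries.map_X, PowerSeries.map_C]
  have hmap1 : MvPowerSeries.map ψ (PowerSeries.C (p : MvPolynomial ℕ ℤ_[p]) * PowerSeries.X :
      PowerSeries (MvPolynomial ℕ ℤ_[p])) = (0 : PowerSeries R) := by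
    change PowerSeries.map ψ _ = _
    rw [_root_.map_mul, PowerSeries.map_X, PowerSeries.map_C, map_natCast, CharP.cast_eq_zero,
      map_zero, zero_mul]
  have e := congrArg (MvPowerSeries.map ψ) (nSeries_killExcept p hab)
  rw [map_subst_pair _ _ (hasSubst_subst_pair _ hs1 (hs _ _)) (hs _ _),
    map_subst_pair _ _ hs1 (hs _ _), hmap, hmap, hmap1] at e
  have e2 : ((bpLaw p).map (killExcept ℤ_[p] a b)).map ψ = (bpLaw p).map ψ := by
    rw [map_map, hψ]
  have e3 := congrArg FormalGroup.toPowerSeries e2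
  change MvPowerSeries.map ψ _ = _ at e3
  rw [e3, FormalGroup.zero_add _ (hsR _ _)] at e
  rw [← e, ← e2, map_nSeries]
  rfl

end PSeries

end TateHonda


/-! ### The one-parameter family containing `F₀` and `H`, and the homomorphisms `τ_c` -/

namespace TateHonda

open FormalGroup

section LawC

variable (p n : ℕ) [Fact p.Prime]

/-- The specialization `p ↦ 0`, `v_{n-1} ↦ 1`, `v_n ↦ c`, `v_i ↦ 0` for `i ≠ n - 1, n`. -/
noncomputable def specialize {R : Type*} [CommRing R] [Algebra (ZMod p) R] (c : R) :
    MvPolynomial ℕ ℤ_[p] →+* R :=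
  MvPolynomial.eval₂Hom ((algebraMap (ZMod p) R).comp PadicInt.toZMod) fun j =>
    if j + 2 = n then 1 else if j + 1 = n then c else 0

/-- The `p`-typical formal group law with `v_{n-1} = 1`, `v_n = c` and `v_i = 0` for
`i ≠ n - 1, n`. -/
noncomputable def lawC {R : Type*} [CommRing R] [Algebra (ZMod p) R] (c : R) : FormalGroup R :=
  (bpLaw p).map (specialize p n c)

theorem constantCoeff_C_mul_X_pow {R : Type*} [CommRing R] (c : R) :
    (PowerSeries.C c * PowerSeries.X ^ p : PowerSeries R).constantCoeff = 0 := by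
  simp [(Fact.out : p.Prime).ne_zero]

variable {R S : Type*} [CommRing R] [Algebra (ZMod p) R] [CommRing S] [Algebra (ZMod p) S]

instance (c : R) : (lawC p n c).IsComm := inferInstanceAs ((bpLaw p).map _).IsComm

/-- All the other data come from `𝔽_p`, which has at most one ring homomorphism to `S`. Applied to
Frobenius, this says that twisting the law only raises the parameter to a power. -/
theorem map_lawC (f : R →+* S) (c : R) : (lawC p n c).map f = lawC p n (f c) := by
  rw [lawC, map_map, lawC]
  congr 1
  refine MvPolynomial.ringHom_ext (fun r => ?_) fun j => ?_
  · simp only [specialize, RingHom.comp_apply, MvPolynomial.coe_eval₂Hom, MvPolynomial.eval₂_C]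
    exact DFunLike.congr_fun
      (Subsingleton.elim (f.comp (algebraMap (ZMod p) R)) (algebraMap (ZMod p) S)) _
  · simp only [specialize, RingHom.comp_apply, MvPolynomial.coe_eval₂Hom, MvPolynomial.eval₂_X]
    split_ifs <;> simp

theorem honda_map (hn : 1 < n) (f : ZMod p →+* R) :
    (honda p (n - 1)).map f = lawC p n (0 : R) := by
  rw [honda, map_map, lawC]
  congr 1
  refine MvPolynomial.ringHom_ext (fun r => ?_) fun j => ?_
  · simp only [specialize, RingHom.comp_apply, MvPolynomial.coe_eval₂Hom, MvPolynomial.eval₂_C]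
    exact DFunLike.congr_fun (Subsingleton.elim f (algebraMap (ZMod p) R)) _
  · simp only [specialize, RingHom.comp_apply, MvPolynomial.coe_eval₂Hom, MvPolynomial.eval₂_X]
    by_cases h : j + 2 = n
    · rw [if_pos (by omega), if_pos h, map_one]
    · rw [if_neg (by omega), if_neg h, ite_self, map_zero]

theorem map_twist_of_eq_one {A B : Type*} [CommRing A] [CommRing B] (F : FormalGroup A) (u : Aˣ)
    (f : A →+* B) (hu : f u = 1) : (F.twist u).map f = F.map f := by
  have hu' : f ((u⁻¹ : Aˣ) : A) = 1 := by
    have := congrArg f u.mul_inv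
    rwa [map_mul, hu, one_mul, map_one] at this
  apply FormalGroup.ext
  ext d
  simp [twist, MvPowerSeries.coeff_rescale, hu, hu', Finsupp.prod]

/-- Passing to degree zero sets `w = 1`, which makes the twist by `w` trivial and sends `v_{n-1} =
w^{q-1}` to `1`. -/
theorem lawF0Poly_eq : lawF0Poly p n =
    lawC p n (-(Polynomial.X ^ ((p - 1) * p ^ (n - 1))) : Polynomial (ZMod p)) := by
  rw [lawF0Poly, lawF, map_twist_of_eq_one, lawG, map_map, map_map, lawC]
  · congr 1
    refine MvPolynomial.ringHom_ext (fun r => ?_) fun j => ?_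
    · simp only [specialize, residueMap, RingHom.comp_apply, MvPolynomial.coe_eval₂Hom,
        MvPolynomial.eval₂_C, AlgHom.toRingHom_eq_coe, RingHom.coe_coe, MvPolynomial.algHom_C,
        MvPolynomial.algebraMap_eq]
      simp
    · simp only [specialize, residueMap, RingHom.comp_apply, MvPolynomial.coe_eval₂Hom,
        MvPolynomial.eval₂_X, AlgHom.toRingHom_eq_coe, RingHom.coe_coe, MvPolynomial.aeval_X]
      by_cases h1 : j + 2 = n
      · rw [if_pos (by omega), if_pos h1, MvPolynomial.eval₂_X, if_pos h1]
        simp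
      · by_cases h2 : j + 1 = n
        · rw [if_pos (by omega), if_neg h1, if_pos h2, MvPolynomial.eval₂_X, if_neg h1, if_pos h2]
          simp
        · rw [if_neg h1, if_neg h2]
          split_ifs with h3
          · rw [MvPolynomial.eval₂_X, if_neg h1, if_neg h2, map_zero]
          · simp
  · simp [unitW]

theorem lawH_eq (hn : 1 < n) : lawH p n = lawC p n (0 : PowerSeries (ZMod p)) :=
  honda_map p n hn _

theorem nSeries_lawC (hn : 1 < n) [CharP R p] (c : R) : (lawC p n c).nSeries p =
    (lawC p n c).toPowerSeries.subst
      ![PowerSeries.X ^ p ^ (n - 1), PowerSeries.C c * PowerSeries.X ^ p ^ n] := by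
  have h := nSeries_map_bpLaw p (specialize p n c) (a := n - 2) (b := n - 1) (by omega)
    fun j h1 h2 => by
      simp only [specialize, MvPolynomial.coe_eval₂Hom, MvPolynomial.eval₂_X]
      rw [if_neg (by omega), if_neg (by omega)]
  have h1 : specialize p n c (MvPolynomial.X (n - 2)) = 1 := by
    simp only [specialize, MvPolynomial.coe_eval₂Hom, MvPolynomial.eval₂_X]
    rw [if_pos (by omega)]
  have h2 : specialize p n c (MvPolynomial.X (n - 1)) = c := by
    simp only [specialize, MvPolynomial.coe_eval₂Hom, MvPolynomial.eval₂_X]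
    rw [if_neg (by omega), if_pos (by omega)]
  rw [h1, h2, map_one, one_mul, show n - 2 + 1 = n - 1 by omega, show n - 1 + 1 = n by omega] at h
  exact h

theorem nSeries_lawC_zero (hn : 1 < n) [CharP R p] :
    (lawC p n (0 : R)).nSeries p = PowerSeries.X ^ p ^ (n - 1) := by
  rw [nSeries_lawC p n hn, map_zero, zero_mul]
  exact FormalGroup.add_zero _ (.of_constantCoeff_zero' (by simp [(Fact.out : p.Prime).ne_zero]))

/-- The series `τ_c(t) = t +_F c t^p`, where `F = lawC c`. -/
noncomputable def tauC (c : R) : PowerSeries R :=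
  (lawC p n c).toPowerSeries.subst ![PowerSeries.X, PowerSeries.C c * PowerSeries.X ^ p]

theorem constantCoeff_tauC (c : R) : (tauC p n c).constantCoeff = 0 :=
  constantCoeff_subst_pair _ PowerSeries.constantCoeff_X (constantCoeff_C_mul_X_pow p c)

theorem map_tauC (f : R →+* S) (c : R) : PowerSeries.map f (tauC p n c) = tauC p n (f c) := by
  have h : MvPowerSeries.map f (PowerSeries.X : PowerSeries R) = (PowerSeries.X : PowerSeries S) :=
    PowerSeries.map_X f
  have h2 : MvPowerSeries.map f (PowerSeries.C c * PowerSeries.X ^ p : PowerSeries R) =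
      (PowerSeries.C (f c) * PowerSeries.X ^ p : PowerSeries S) := by
    change PowerSeries.map f _ = _
    rw [_root_.map_mul, _root_.map_pow, PowerSeries.map_X, PowerSeries.map_C]
  refine (map_subst_pair _ f PowerSeries.HasSubst.X'
    (.of_constantCoeff_zero' (constantCoeff_C_mul_X_pow p c))).trans ?_
  rw [h, h2, tauC, ← map_lawC p n f c]
  rfl

theorem tauC_zero : tauC p n (0 : R) = PowerSeries.X := by
  rw [tauC, map_zero, zero_mul]
  exact FormalGroup.add_zero _ PowerSeries.HasSubst.X'

theorem coeff_one_tauC (c : R) : (tauC p n c).coeff 1 = 1 := by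
  have hp := (Fact.out : p.Prime)
  have hs := hasSubst_pair (PowerSeries.HasSubst.X' (R := R))
    (.of_constantCoeff_zero' (constantCoeff_C_mul_X_pow p c))
  have key : ∀ d : Fin 2 →₀ ℕ, (d.prod fun s e =>
      (![PowerSeries.X, PowerSeries.C c * PowerSeries.X ^ p] : Fin 2 → PowerSeries R) s ^ e) =
        PowerSeries.C (c ^ d 1) * PowerSeries.X ^ (d 0 + p * d 1) := fun d => by
    rw [Finsupp.prod_fintype _ _ fun _ => pow_zero _, Fin.prod_univ_two]
    simp only [Matrix.cons_val_zero, Matrix.cons_val_one, mul_pow, map_pow, pow_add, pow_mul]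
    ring
  have h := MvPowerSeries.coeff_subst hs (lawC p n c).toPowerSeries (Finsupp.single () 1)
  refine h.trans ?_
  rw [finsum_eq_single _ (Finsupp.single 0 1)]
  · have := key (Finsupp.single 0 1)
    refine (congrArg (fun x => (MvPowerSeries.coeff (Finsupp.single 0 1))
      (lawC p n c).toPowerSeries • PowerSeries.coeff 1 x) this).trans ?_
    simp [(lawC p n c).lin_coeff_X]
  · intro d hd
    refine (congrArg (fun x => (MvPowerSeries.coeff d)
      (lawC p n c).toPowerSeries • PowerSeries.coeff 1 x) (key d)).trans ?_
    rw [PowerSeries.coeff_C_mul, PowerSeries.coeff_X_pow, if_neg, mul_zero, smul_zero]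
    intro h1
    refine hd ?_
    -- A monomial involving `c t^p` has degree at least `p ≥ 2` in `t`, so only the linear term in
    -- the first argument contributes.
    have h2 : d 1 = 0 := by
      by_contra h3
      have : p ≤ p * d 1 := Nat.le_mul_of_pos_right p (Nat.pos_of_ne_zero h3)
      have := hp.two_le
      omega
    ext i
    fin_cases i
    · simp [h2] at h1 ⊢
      omega
    · simp [h2]

/-- The `q`-th power of a formal sum is the sum of the `q`-th powers in the Frobenius-twisted law
`lawC (c^q)`. Here the summands become `t^q` and `c^q t^{pq}`, as in the Araki formula. -/
theorem tauC_pow (hn : 1 < n) [CharP R p] (c : R) :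
    tauC p n c ^ p ^ (n - 1) = (lawC p n (c ^ p ^ (n - 1))).nSeries p := by
  refine (subst_pair_pow_char_pow p (lawC p n c) (n - 1) PowerSeries.HasSubst.X'
    (.of_constantCoeff_zero' (constantCoeff_C_mul_X_pow p c))).trans ?_
  rw [nSeries_lawC p n hn, map_lawC, iterateFrobenius_def]
  congr 3
  change (_ * _) ^ _ = _
  rw [mul_pow, ← map_pow, ← pow_mul, ← pow_succ', show n - 1 + 1 = n by omega]

/-- After taking `q`-th powers, the claim says that `[p]` is an endomorphism of the commutative law
`lawC (c^q)`. Uniqueness of `q`-th roots brings it back to `τ_c`. -/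
theorem isHom_tauC (hn : 1 < n) [CharP R p] [IsReduced R] (c : R) :
    IsHom (lawC p n (c ^ p ^ (n - 1))) (lawC p n c) (tauC p n c) := by
  have h0 := constantCoeff_tauC p n c
  refine ⟨h0, MvPowerSeries.pow_char_pow_injective p (n - 1) ?_⟩
  have hX : ∀ i : Fin 2, PowerSeries.HasSubst (MvPowerSeries.X i : MvPowerSeries (Fin 2) R) :=
    fun i => PowerSeries.HasSubst.X i
  have hF : (lawC p n (c ^ p ^ (n - 1))).toPowerSeries.subst
      ![MvPowerSeries.X 0, MvPowerSeries.X 1] = (lawC p n (c ^ p ^ (n - 1))).toPowerSeries := by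
    have : (![MvPowerSeries.X 0, MvPowerSeries.X 1] : Fin 2 → MvPowerSeries (Fin 2) R) =
        MvPowerSeries.X := by
      funext i; fin_cases i <;> rfl
    rw [this, MvPowerSeries.subst_self]
    rfl
  dsimp only
  rw [subst_pair_pow_char_pow p _ _ (hasSubst_subst h0 (hX 0)) (hasSubst_subst h0 (hX 1)),
    map_lawC, iterateFrobenius_def, ← PowerSeries.subst_pow (hX 0), ← PowerSeries.subst_pow (hX 1),
    ← PowerSeries.subst_pow (hasSubst_toPowerSeries _), tauC_pow p n hn,
    ← subst_nSeries _ (hX 0) (hX 1), hF]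

/-- The compositional inverse of `τ_c`. -/
noncomputable def rhoC (c : R) : PowerSeries R :=
  (tauC p n c).substInvOfIsUnit (by rw [coeff_one_tauC]; exact isUnit_one)

theorem isCompInverse_rhoC (c : R) : IsCompInverse (tauC p n c) (rhoC p n c) :=
  ⟨PowerSeries.constantCoeff_substInvOfIsUnit _ _,
    PowerSeries.subst_substInvOfIsUnit_right _ (constantCoeff_tauC p n c) _,
    PowerSeries.subst_substInvOfIsUnit_left _ (constantCoeff_tauC p n c) _⟩

theorem IsCompInverse.unique {A : Type*} [CommRing A] {τ ρ ρ' : PowerSeries A}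
    (hτ : τ.constantCoeff = 0) (h : IsCompInverse τ ρ) (h' : IsCompInverse τ ρ') : ρ' = ρ := by
  rw [← comp_X ρ', ← h.2.1, comp_assoc hτ h.1, h'.2.2, X_comp h.1]

theorem IsCompInverse.map {A B : Type*} [CommRing A] [CommRing B] {τ ρ : PowerSeries A}
    (hτ : τ.constantCoeff = 0) (h : IsCompInverse τ ρ) (f : A →+* B) :
    IsCompInverse (PowerSeries.map f τ) (PowerSeries.map f ρ) := by
  refine ⟨?_, ?_, ?_⟩
  · rw [← PowerSeries.coeff_zero_eq_constantCoeff_apply, PowerSeries.coeff_map,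
      PowerSeries.coeff_zero_eq_constantCoeff_apply, h.1, map_zero]
  · rw [← map_comp f h.1, h.2.1, PowerSeries.map_X]
  · rw [← map_comp f hτ, h.2.2, PowerSeries.map_X]

theorem map_rhoC (f : R →+* S) (c : R) : PowerSeries.map f (rhoC p n c) = rhoC p n (f c) := by
  have h := (isCompInverse_rhoC p n c).map (constantCoeff_tauC p n c) f
  rw [map_tauC] at h
  exact (isCompInverse_rhoC p n (f c)).unique (constantCoeff_tauC p n _) h

theorem rhoC_zero : rhoC p n (0 : R) = PowerSeries.X := by
  have h := isCompInverse_rhoC p n (0 : R)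
  rw [← X_comp h.1, ← tauC_zero p n, h.2.1, tauC_zero]

theorem coeff_one_rhoC (c : R) : (rhoC p n c).coeff 1 = 1 := by
  have h := isCompInverse_rhoC p n c
  have h1 := congrArg (PowerSeries.coeff 1) h.2.1
  rwa [coeff_one_comp h.1, coeff_one_tauC, one_mul, PowerSeries.coeff_one_X] at h1

theorem isHom_rhoC (hn : 1 < n) [CharP R p] [IsReduced R] (c : R) :
    IsHom (lawC p n c) (lawC p n (c ^ p ^ (n - 1))) (rhoC p n c) :=
  have h := isCompInverse_rhoC p n c
  (isHom_tauC p n hn c).of_comp_eq_X h.1 h.2.1 h.2.2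

end LawC

end TateHonda


/-! ### The `(y⁻¹)`-adic topology -/

namespace TateHonda

open FormalGroup

section Limit

variable (p : ℕ) [Fact p.Prime]

/-- The reduction `𝔽_p⟦y⁻¹⟧ → 𝔽_p⟦y⁻¹⟧ / (y⁻¹)^N`. -/
noncomputable abbrev modX (N : ℕ) : PowerSeries (ZMod p) →+*
    PowerSeries (ZMod p) ⧸ Ideal.span {(PowerSeries.X : PowerSeries (ZMod p)) ^ N} :=
  Ideal.Quotient.mk _

/-- The reduction `𝔽_p[y⁻¹] → 𝔽_p⟦y⁻¹⟧ / (y⁻¹)^N`. -/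
noncomputable abbrev polyModX (N : ℕ) : Polynomial (ZMod p) →+*
    PowerSeries (ZMod p) ⧸ Ideal.span {(PowerSeries.X : PowerSeries (ZMod p)) ^ N} :=
  (modX p N).comp Polynomial.coeToPowerSeries.ringHom

variable {p}

theorem modX_eq_iff {N : ℕ} {a b : PowerSeries (ZMod p)} :
    modX p N a = modX p N b ↔ PowerSeries.X ^ N ∣ a - b := by
  rw [Ideal.Quotient.eq, Ideal.mem_span_singleton]

/-- Congruences become equalities over a quotient ring, where compatibility of composition and
formal group laws with base change can be used directly. -/
theorem congrMod_iff {N : ℕ} {f g : PowerSeries (PowerSeries (ZMod p))} :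
    CongrMod p N f g ↔ PowerSeries.map (modX p N) f = PowerSeries.map (modX p N) g := by
  rw [PowerSeries.ext_iff]
  refine forall_congr' fun k => ?_
  rw [PowerSeries.coeff_map, PowerSeries.coeff_map, modX_eq_iff, map_sub]

theorem eq_zero_of_forall_X_pow_dvd {a : PowerSeries (ZMod p)}
    (h : ∀ N : ℕ, PowerSeries.X ^ N ∣ a) : a = 0 := by
  ext i
  exact PowerSeries.X_pow_dvd_iff.mp (h (i + 1)) i (Nat.lt_succ_self i)

theorem eq_of_forall_modX_eq {a b : PowerSeries (ZMod p)}
    (h : ∀ N : ℕ, modX p N a = modX p N b) : a = b :=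
  sub_eq_zero.mp (eq_zero_of_forall_X_pow_dvd fun N => modX_eq_iff.mp (h N))

theorem eq_of_forall_congrMod {f g : PowerSeries (PowerSeries (ZMod p))}
    (h : ∀ N : ℕ, CongrMod p N f g) : f = g := by
  ext1 k
  refine eq_of_forall_modX_eq fun N => ?_
  rw [← PowerSeries.coeff_map, congrMod_iff.mp (h N), PowerSeries.coeff_map]

theorem CongrMod.mono {M N : ℕ} (hMN : M ≤ N) {f g : PowerSeries (PowerSeries (ZMod p))}
    (h : CongrMod p N f g) : CongrMod p M f g :=
  fun k => (pow_dvd_pow _ hMN).trans (h k)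

theorem CongrMod.symm {N : ℕ} {f g : PowerSeries (PowerSeries (ZMod p))}
    (h : CongrMod p N f g) : CongrMod p N g f :=
  congrMod_iff.mpr (congrMod_iff.mp h).symm

theorem CongrMod.trans {N : ℕ} {f g k : PowerSeries (PowerSeries (ZMod p))}
    (h : CongrMod p N f g) (h' : CongrMod p N g k) : CongrMod p N f k :=
  congrMod_iff.mpr ((congrMod_iff.mp h).trans (congrMod_iff.mp h'))

theorem congrMod_map_coe_iff {N : ℕ} {f g : PowerSeries (Polynomial (ZMod p))} :
    CongrMod p N (PowerSeries.map Polynomial.coeToPowerSeries.ringHom f)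
      (PowerSeries.map Polynomial.coeToPowerSeries.ringHom g) ↔
    PowerSeries.map (polyModX p N) f = PowerSeries.map (polyModX p N) g := by
  rw [congrMod_iff, polyModX, PowerSeries.map_comp, RingHom.comp_apply, RingHom.comp_apply]

/-- A sequence in `𝔽_p[y⁻¹]⟦t⟧` whose `(r+1)`-st and `r`-th terms agree modulo `(y⁻¹)^{r+1}`
converges in `𝔽_p⟦y⁻¹⟧⟦t⟧`. -/
theorem exists_limit (P : ℕ → PowerSeries (PowerSeries (ZMod p)))
    (h : ∀ r, CongrMod p (r + 1) (P (r + 1)) (P r)) :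
    ∃ Φ, ∀ N r, N ≤ r + 1 → CongrMod p N (P r) Φ := by
  have hP : ∀ N r s, N ≤ r + 1 → r ≤ s → CongrMod p N (P s) (P r) := fun N r s hN hrs => by
    induction s, hrs using Nat.le_induction with
    | base => exact congrMod_iff.mpr rfl
    | succ s hs ih => exact ((h s).mono (by omega)).trans ih
  -- A diagonal choice: the coefficient of `y^{-i}` no longer changes from the term `P i` on.
  refine ⟨PowerSeries.mk fun k => PowerSeries.mk fun i =>
    PowerSeries.coeff i (PowerSeries.coeff k (P i)), fun N r hN k => ?_⟩
  rw [PowerSeries.X_pow_dvd_iff]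
  intro i hi
  rw [map_sub, PowerSeries.coeff_mk, map_sub, PowerSeries.coeff_mk, sub_eq_zero]
  have h1 := PowerSeries.X_pow_dvd_iff.mp (hP (i + 1) i r le_rfl (by omega) k) i (Nat.lt_succ_self i)
  rwa [map_sub, map_sub, sub_eq_zero] at h1

end Limit

/-! ### Convergence to `Φ`, and rigidity of homomorphisms to `H` -/

section Main

variable (p n : ℕ) [Fact p.Prime]

theorem sigmaTwist_rhoC (r : ℕ) (c : Polynomial (ZMod p)) :
    sigmaTwist p n r (rhoC p n c) = rhoC p n (c ^ p ^ ((n - 1) * r)) := by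
  rw [sigmaTwist, map_rhoC, iterateFrobenius_def]

variable {n}

/-- The factor `τ^{-σ^r}` is the inverse of `τ_c` at parameter `c^{q^r}`, so consecutive factors
have matching source and target. -/
theorem isHom_partialComp (hn : 1 < n) (c : Polynomial (ZMod p)) (r : ℕ) :
    IsHom (lawC p n (c ^ p ^ (n - 1))) (lawC p n (c ^ p ^ ((n - 1) * (r + 1))))
      (partialComp p n (rhoC p n c) r) := by
  induction r with
  | zero =>
    rw [_root_.zero_add, mul_one, partialComp]
    exact isHom_X _
  | succ r ih =>
    rw [partialComp, sigmaTwist_rhoC]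
    have h := isHom_rhoC p n hn (c ^ p ^ ((n - 1) * (r + 1)))
    rw [← pow_mul, ← pow_add, ← Nat.mul_succ] at h
    exact h.comp ih

theorem coeff_one_partialComp (hn : 1 < n) (c : Polynomial (ZMod p)) (r : ℕ) :
    (partialComp p n (rhoC p n c) r).coeff 1 = 1 := by
  induction r with
  | zero => rw [partialComp, PowerSeries.coeff_one_X]
  | succ r ih =>
    rw [partialComp, sigmaTwist_rhoC, coeff_one_comp (isHom_partialComp p hn c r).1, ih,
      coeff_one_rhoC, one_mul]

theorem le_pow_mul (hn : 1 < n) (r : ℕ) : r ≤ p ^ ((n - 1) * r) :=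
  (Nat.le_mul_of_pos_left r (by omega)).trans (Nat.lt_pow_self (Fact.out : p.Prime).one_lt).le

variable {c : Polynomial (ZMod p)}

/-- The parameter is divisible by `y⁻¹`, and its exponent `q^r` is at least `r`. -/
theorem polyModX_pow_eq_zero (hn : 1 < n) (hc : Polynomial.X ∣ c) {N r : ℕ} (h : N ≤ r) :
    polyModX p N (c ^ p ^ ((n - 1) * r)) = 0 := by
  rw [RingHom.comp_apply, Ideal.Quotient.eq_zero_iff_mem, Ideal.mem_span_singleton]
  have h1 := map_dvd (Polynomial.coeToPowerSeries.ringHom (R := ZMod p))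
    ((pow_dvd_pow Polynomial.X (h.trans (le_pow_mul p hn r))).trans (pow_dvd_pow_of_dvd hc _))
  rw [map_pow, Polynomial.coeToPowerSeries.ringHom_apply, Polynomial.coe_X] at h1
  exact h1

theorem map_polyModX_partialComp_succ (hn : 1 < n) (hc : Polynomial.X ∣ c) (r : ℕ) :
    PowerSeries.map (polyModX p (r + 1)) (partialComp p n (rhoC p n c) (r + 1)) =
      PowerSeries.map (polyModX p (r + 1)) (partialComp p n (rhoC p n c) r) := by
  have h0 := (isHom_partialComp p hn c r).1
  rw [partialComp, sigmaTwist_rhoC, map_comp _ h0, map_rhoC, polyModX_pow_eq_zero p hn hc le_rfl,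
    rhoC_zero, X_comp]
  rw [← PowerSeries.coeff_zero_eq_constantCoeff_apply, PowerSeries.coeff_map,
    PowerSeries.coeff_zero_eq_constantCoeff_apply, h0, map_zero]

/-- A limit of the finite composites is a strict isomorphism. -/
theorem isStrictIso_of_limit (hn : 1 < n) (hc : Polynomial.X ∣ c)
    {Φ : PowerSeries (PowerSeries (ZMod p))}
    (hΦ : ∀ N r, N ≤ r + 1 → CongrMod p N (PowerSeries.map Polynomial.coeToPowerSeries.ringHom
      (partialComp p n (rhoC p n c) r)) Φ) :
    IsStrictIso (lawC p n (c ^ p ^ (n - 1) : PowerSeries (ZMod p))) (lawC p n 0) Φ := by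
  have hcoeff : ∀ N r k, N ≤ r + 1 → modX p N (PowerSeries.coeff k Φ) =
      polyModX p N (PowerSeries.coeff k (partialComp p n (rhoC p n c) r)) := fun N r k h => by
    rw [← PowerSeries.coeff_map, ← congrMod_iff.mp (hΦ N r h), PowerSeries.coeff_map,
      PowerSeries.coeff_map, RingHom.comp_apply]
  have h0 : Φ.constantCoeff = 0 := by
    refine eq_of_forall_modX_eq fun N => ?_
    rw [← PowerSeries.coeff_zero_eq_constantCoeff_apply, hcoeff N N 0 (Nat.le_succ N),
      PowerSeries.coeff_zero_eq_constantCoeff_apply, (isHom_partialComp p hn c N).1, map_zero,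
      map_zero]
  have hX : ∀ i : Fin 2, PowerSeries.HasSubst
      (MvPowerSeries.X i : MvPowerSeries (Fin 2) (PowerSeries (ZMod p))) :=
    fun i => PowerSeries.HasSubst.X i
  refine ⟨h0, ?_, ?_⟩
  · refine eq_of_forall_modX_eq fun N => ?_
    rw [hcoeff N N 1 (Nat.le_succ N), coeff_one_partialComp p hn, map_one, map_one]
  · ext1 d
    refine eq_of_forall_modX_eq fun N => ?_
    rw [← MvPowerSeries.coeff_map, ← MvPowerSeries.coeff_map]
    congr 1
    have h := ((isHom_partialComp p hn c N).map (polyModX p N)).map_add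
    have hP : PowerSeries.map (polyModX p N) (partialComp p n (rhoC p n c) N) =
        PowerSeries.map (modX p N) Φ := by
      rw [← congrMod_iff.mp (hΦ N N (Nat.le_succ N)), polyModX, PowerSeries.map_comp,
        RingHom.comp_apply]
    have hF : (lawC p n (c ^ p ^ (n - 1))).map (polyModX p N) =
        (lawC p n (c ^ p ^ (n - 1) : PowerSeries (ZMod p))).map (modX p N) := by
      rw [map_lawC, map_lawC, RingHom.comp_apply, map_pow,
        Polynomial.coeToPowerSeries.ringHom_apply]
    -- Modulo `y^{-N}` the parameter of the target vanishes, so the composite already lands in the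
    -- Honda law.
    have hG : (lawC p n (c ^ p ^ ((n - 1) * (N + 1)))).map (polyModX p N) =
        (lawC p n (0 : PowerSeries (ZMod p))).map (modX p N) := by
      rw [map_lawC, map_lawC, polyModX_pow_eq_zero p hn hc (Nat.le_succ N), map_zero]
    rw [hP, hF, hG] at h
    rw [PowerSeries.map_subst (hasSubst_toPowerSeries _), map_subst_pair _ _
      (hasSubst_subst h0 (hX 0)) (hasSubst_subst h0 (hX 1)), PowerSeries.map_subst (hX 0),
      PowerSeries.map_subst (hX 1), MvPowerSeries.map_X, MvPowerSeries.map_X]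
    exact h

theorem comp_X_pow {R : Type*} [CommRing R] {f : PowerSeries R} (hf : f.constantCoeff = 0)
    (k : ℕ) : comp (PowerSeries.X ^ k) f = f ^ k := by
  rw [comp, PowerSeries.subst_pow (.of_constantCoeff_zero' hf),
    PowerSeries.subst_X (.of_constantCoeff_zero' hf)]

/-- The equation for `τ` reads `τ_c^q = τ^q`, because the `p`-series of the Honda law is `t^q`. -/
theorem isTau_iff (hn : 1 < n) (hc : lawF0Poly p n = lawC p n (c ^ p ^ (n - 1)))
    (τ : PowerSeries (Polynomial (ZMod p))) : IsTau p n τ ↔ τ = tauC p n c := by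
  have key : ∀ {σ : PowerSeries (Polynomial (ZMod p))}, σ.constantCoeff = 0 →
      comp (((honda p (n - 1)).map Polynomial.C).nSeries p) σ = σ ^ p ^ (n - 1) := fun hσ => by
    rw [honda_map p n hn, nSeries_lawC_zero p n hn, comp_X_pow hσ]
  rw [IsTau, hc, ← tauC_pow p n hn]
  constructor
  · rintro ⟨h0, h⟩
    rw [key h0] at h
    exact (MvPowerSeries.pow_char_pow_injective p (n - 1) h).symm
  · rintro rfl
    exact ⟨constantCoeff_tauC p n c, (key (constantCoeff_tauC p n c)).symm⟩

/-- A homomorphism from `lawC (c^q)` to the Honda law intertwines `τ^σ` with the Frobenius. -/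
theorem comp_tauC_eq_map_iterateFrobenius (hn : 1 < n) {R : Type*} [CommRing R]
    [Algebra (ZMod p) R] [CharP R p] (c : R) {Ψ : PowerSeries R}
    (h : IsHom (lawC p n (c ^ p ^ (n - 1))) (lawC p n 0) Ψ) :
    comp Ψ (tauC p n (c ^ p ^ (n - 1))) = PowerSeries.map (iterateFrobenius R p (n - 1)) Ψ := by
  -- Compatibility with `[p]` says that `Ψ ∘ τ_c^q` equals `Ψ^q`. Both `q`-th powers are series in
  -- `t^q` with Frobenius-twisted coefficients, so replacing `t^q` by `t` gives the claim.
  have e := h.comp_nSeries p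
  rw [nSeries_lawC_zero p n hn, comp_X_pow h.1, ← tauC_pow p n hn, PowerSeries.pow_char_pow_eq_expand,
    PowerSeries.pow_char_pow_eq_expand p (n - 1) Ψ, map_tauC, iterateFrobenius_def, comp] at e
  refine PowerSeries.expand_injective (pow_ne_zero (n - 1) (expChar_ne_zero R p)) ?_
  refine Eq.trans ?_ e
  exact PowerSeries.expand_subst _ _ (.of_constantCoeff_zero' (constantCoeff_tauC p n _)) Ψ

theorem charP_powerSeries_zmod : CharP (PowerSeries (ZMod p)) p :=
  charP_of_injective_ringHom (PowerSeries.C_injective (R := ZMod p)) p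

/-- Two homomorphisms to the Honda law that agree modulo `y⁻¹` are equal. -/
theorem eq_of_isHom_of_congrMod_one (hn : 1 < n) (c : PowerSeries (ZMod p))
    {Φ Ψ : PowerSeries (PowerSeries (ZMod p))}
    (hΦ : IsHom (lawC p n (c ^ p ^ (n - 1))) (lawC p n 0) Φ)
    (hΨ : IsHom (lawC p n (c ^ p ^ (n - 1))) (lawC p n 0) Ψ)
    (h : CongrMod p 1 Ψ Φ) : Ψ = Φ := by
  have hp := (Fact.out : p.Prime)
  have := charP_powerSeries_zmod p
  have key : ∀ N, CongrMod p (N + 1) Ψ Φ := fun N => by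
    induction N with
    | zero => exact h
    | succ N ih =>
      -- Both composites are Frobenius twists, and the `q`-th power of a multiple of `y^{-(N+1)}` is
      -- divisible by `y^{-q(N+1)}`, where `q(N+1) ≥ N+2`.
      have h1 : CongrMod p (N + 2) (comp Ψ (tauC p n (c ^ p ^ (n - 1))))
          (comp Φ (tauC p n (c ^ p ^ (n - 1)))) := by
        rw [comp_tauC_eq_map_iterateFrobenius p hn c hΨ,
          comp_tauC_eq_map_iterateFrobenius p hn c hΦ]
        intro k
        rw [map_sub, PowerSeries.coeff_map, PowerSeries.coeff_map, ← map_sub, ← map_sub,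
          iterateFrobenius_def]
        have h2 := pow_dvd_pow_of_dvd (ih k) (p ^ (n - 1))
        rw [← pow_mul] at h2
        refine (pow_dvd_pow _ ?_).trans h2
        have := Nat.one_lt_pow (n := n - 1) (by omega) hp.one_lt
        nlinarith
      obtain ⟨hρ0, hρ, -⟩ := isCompInverse_rhoC p n (c ^ p ^ (n - 1))
      have hτ0 := constantCoeff_tauC p n (c ^ p ^ (n - 1))
      -- Composing on the right with the inverse of `τ^σ` over the quotient removes `τ^σ` from the
      -- congruence.
      have h2 := congrArg (fun f => comp f (PowerSeries.map (modX p (N + 2))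
        (rhoC p n (c ^ p ^ (n - 1))))) (congrMod_iff.mp h1)
      simp only [← map_comp _ hρ0, ← comp_assoc hτ0 hρ0, hρ, comp_X] at h2
      exact congrMod_iff.mpr h2
  exact eq_of_forall_congrMod fun N => (key N).mono (Nat.le_succ N)

theorem lawH_nSeries (hn : 1 < n) :
    (lawH p n).nSeries p = PowerSeries.X ^ p ^ (n - 1) := by
  have := charP_powerSeries_zmod p
  rw [lawH_eq p n hn, nSeries_lawC_zero p n hn]

end Main

end TateHonda

theorem mainTheorem10 (p n : ℕ) [Fact p.Prime] (hp : p ≠ 2) (hn : 1 < n) :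
    TateHonda.HasArakiLog p (TateHonda.bpLaw p) ∧
    (TateHonda.lawH p n).nSeries p = PowerSeries.X ^ p ^ (n - 1) ∧
    (∃! τ, TateHonda.IsTau p n τ) ∧
    ∃ Φ : PowerSeries (PowerSeries (ZMod p)),
      (∀ Φ', TateHonda.IsPhi p n Φ' ↔ Φ' = Φ) ∧
      FormalGroup.IsStrictIso (TateHonda.lawF0 p n) (TateHonda.lawH p n) Φ ∧
      TateHonda.CongrMod p 1 Φ PowerSeries.X ∧
      ∀ Ψ : PowerSeries (PowerSeries (ZMod p)),
        FormalGroup.IsStrictIso (TateHonda.lawF0 p n) (TateHonda.lawH p n) Ψ →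
        TateHonda.CongrMod p 1 Ψ PowerSeries.X → Ψ = Φ := by
  open TateHonda FormalGroup in
  have hprime := (Fact.out : p.Prime)
  have hodd : Odd (p ^ (n - 1)) := (hprime.odd_of_ne_two hp).pow
  -- This is a `q`-th root of the parameter `-y^{(1-p)q}` of `F₀`; the sign survives the `q`-th
  -- power because `p` is odd.
  let c : Polynomial (ZMod p) := -Polynomial.X ^ (p - 1)
  have hXc : Polynomial.X ∣ c :=
    (dvd_neg.mpr (dvd_pow_self _ (by have := hprime.two_le; omega)))
  have hcq : c ^ p ^ (n - 1) = -(Polynomial.X ^ ((p - 1) * p ^ (n - 1))) := by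
    rw [hodd.neg_pow, ← pow_mul]
  have hF : lawF0Poly p n = lawC p n (c ^ p ^ (n - 1)) := by rw [hcq, lawF0Poly_eq]
  have hF0 : lawF0 p n = lawC p n ((c : PowerSeries (ZMod p)) ^ p ^ (n - 1)) := by
    rw [lawF0, hF, map_lawC, map_pow, Polynomial.coeToPowerSeries.ringHom_apply]
  have hτ := isTau_iff p hn hF
  obtain ⟨Φ, hΦ⟩ := exists_limit
    (fun r => PowerSeries.map Polynomial.coeToPowerSeries.ringHom
      (partialComp p n (rhoC p n c) r))
    fun r => congrMod_map_coe_iff.mpr (map_polyModX_partialComp_succ p hn hXc r)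
  have hiso := isStrictIso_of_limit p hn hXc hΦ
  have hX : CongrMod p 1 Φ PowerSeries.X := by
    -- The empty composite, which is `t`, already agrees with the limit modulo `y⁻¹`.
    have h := (hΦ 1 0 le_rfl).symm
    rwa [partialComp, PowerSeries.map_X] at h
  refine ⟨hasArakiLog_bpLaw p, lawH_nSeries p hn, ⟨tauC p n c, (hτ _).mpr rfl, fun τ h =>
    (hτ τ).mp h⟩, Φ, fun Φ' => ⟨?_, ?_⟩, ?_, hX, ?_⟩
  · rintro ⟨τ, ρ, h, hρ, hlim⟩
    obtain rfl := (hτ τ).mp h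
    obtain rfl := (isCompInverse_rhoC p n c).unique (constantCoeff_tauC p n c) hρ
    refine eq_of_forall_congrMod fun N => ?_
    obtain ⟨r₀, hr₀⟩ := hlim N
    exact (hr₀ (max r₀ N) (le_max_left _ _)).symm.trans
      (hΦ N (max r₀ N) ((le_max_right _ _).trans (Nat.le_succ _)))
  · rintro rfl
    exact ⟨tauC p n c, rhoC p n c, (hτ _).mpr rfl, isCompInverse_rhoC p n c, fun N =>
      ⟨N, fun r hr => hΦ N r (hr.trans (Nat.le_succ r))⟩⟩
  · rw [hF0, lawH_eq p n hn]
    exact hiso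
  · intro Ψ hΨ hΨX
    rw [hF0, lawH_eq p n hn] at hΨ
    exact eq_of_isHom_of_congrMod_one p hn _ (isStrictIso_iff.mp hiso).1 (isStrictIso_iff.mp hΨ).1
      (hΨX.trans hX.symm)
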